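/- Let $m\ge 2$, let $E$ be an oriented smooth real vector bundle of rank $4$ over $\mathbb{R}^m$ with a neutral metric $h$ (signature $(2,2)$), and let $\nabla$ be a flat $h$-connection of $E$ (that is, $\nabla h=0$ and the curvature vanishes). Let $e=(e_1,e_2,e_3,e_4)$ be a smooth ordered pseudo-orthonormal frame field of $E$ over $\mathbb{R}^m$ giving the orientation, with $e_1,e_2$ space-like and $e_3,e_4$ time-like, and let $\omega=[\omega^i_j]$ be the connection form, $\nabla e=e\omega$, i.e. $\nabla e_j=\sum_i\omega^i_j\otimes e_i$. Let $\hat h$ and $\hat\nabla$ be the metric and the connection of $\bigwedge^2E$ induced by $h$ and $\nabla$, and put $$\Omega_{\pm,1}=\tfrac1{\sqrt2}(e_1\wedge e_2\pm e_3\wedge e_4),\quad \Omega_{\pm,2}=\tfrac1{\sqrt2}(e_1\wedge e_3\pm e_4\wedge e_2),\quad \Omega_{\pm,3}=\tfrac1{\sqrt2}(e_1\wedge e_4\pm e_2\wedge e_3).$$ For a section $\Omega$ of $\bigwedge^2E$, $\hat\nabla\Omega$ is called fully light-like if at every point all vectors $\hat\nabla_v\Omega$ are null for $\hat h$ and not all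 of them are zero. Let $\varepsilon\in\{+,-\}$. (1) The following are equivalent: (a) $\hat\nabla\Omega_{\varepsilon,2}$ is fully light-like; (b) there are $\mu\in\{+,-\}$ and smooth functions $f,g$ on $\mathbb{R}^m$ with $dg$ nowhere zero such that $$\omega^4_1=\varepsilon e^{\mu f}dg-\varepsilon\omega^3_2,\quad \omega^4_2=\varepsilon\omega^3_1-df,\quad \omega^4_3=\mu e^{\mu f}dg-\varepsilon\omega^2_1$$ and $$d\omega^2_1=2\omega^3_1\wedge\omega^3_2-e^{\mu f}\omega^3_1\wedge dg+\varepsilon\omega^3_2\wedge df+\varepsilon e^{\mu f}df\wedge dg,$$ $$d\omega^3_1=2\omega^2_1\wedge\omega^3_2-e^{\mu f}\omega^2_1\wedge dg+\varepsilon\mu e^{\mu f}\omega^3_2\wedge dg,$$ $$d\omega^3_2=-2\omega^2_1\wedge\omega^3_1+\varepsilon\omega^2_1\wedge df-\varepsilon\mu e^{\mu f}\omega^3_1\wedge dg+\mu e^{\mu f}df\wedge dg.$$ (2) If $\mu,f,g$ are as in (b), then $\hat\nabla\Omega_{\varepsilon,2}=\alpha\otimes\Omega_0$ with $\alpha=e^{\mu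 f}dg$ and $\Omega_0=\Omega_{-\varepsilon,1}+\mu\Omega_{\varepsilon,3}$. Moreover $\Omega_0$ can be made horizontal: there is a smooth ordered pseudo-orthonormal frame field $e'$ over $\mathbb{R}^m$ giving the orientation (with $e'_1,e'_2$ space-like and $e'_3,e'_4$ time-like) such that $\Omega'_{\varepsilon,2}=\Omega_{\varepsilon,2}$, $\hat\nabla\Omega_{\varepsilon,2}=\alpha'\otimes\Omega'_0$ for a nowhere zero smooth $1$-form $\alpha'$, and $\hat\nabla\Omega'_0=0$, where $\Omega'_{\varepsilon,2}$ and $\Omega'_0=\Omega'_{-\varepsilon,1}+\mu\Omega'_{\varepsilon,3}$ are formed from $e'$. (3) Let $E=TE^4_2$ be the tangent bundle of $E^4_2=\mathbb{R}^4$ with the metric $h=dx_1^2+dx_2^2-dx_3^2-dx_4^2$ and either orientation, and let $\nabla$ be the Levi-Civita connection of $h$. Then (1) and (2) hold for every frame field $e$ as above. If in addition (a) (equivalently (b)) holds, then there exists an almost $\varepsilon$-paracomplex structure $J$ of $E^4_2$ corresponding to $\Omega_{\varepsilon,2}$, that is, with $h(Jx,y)=\sqrt2\,\hat h(\Omega_{\varepsilon,2},x\wedge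 y)$ for all $x,y$ (equivalently $Je_1=e_3$, $Je_2=-\varepsilon e_4$, $Je_3=e_1$, $Je_4=-\varepsilon e_2$), and for each such $J$ the values $(\nabla_vJ)w$ of $\nabla J$ span at each point the fibre of a smooth light-like two-dimensional distribution $\mathscr{D}_J$, and $(E^4_2,h,\mathscr{D}_J)$ is a Walker manifold, i.e. the covariant derivatives of local sections of $\mathscr{D}_J$ by any tangent vector are contained in $\mathscr{D}_J$. Here an almost $\varepsilon$-paracomplex structure is a section $J$ of $\mathrm{End}\,TE^4_2$ with $J^2=\mathrm{id}$, with both eigenspaces (for $\pm1$) of dimension $2$, with $h(Jx,Jy)=-h(x,y)$, and such that near each point there is a smooth ordered pseudo-orthonormal frame field $u=(u_1,\dots,u_4)$ giving the orientation, with $u_1,u_2$ space-like and $u_3,u_4$ time-like, satisfying $Ju_1=u_3$, $Ju_2=-\varepsilon u_4$, $Ju_3=u_1$, $Ju_4=-\varepsilon u_2$. -/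

import Mathlib

open Bundle Module
open scoped Manifold ContDiff Topology

universe u v

attribute [-instance] TopCat.of.chartedSpace TopCat.of.hasGroupoid

noncomputable section

namespace FlatNeutral

/-- The base manifold `ℝᵐ`. -/
abbrev Base (m : ℕ) : Type := EuclideanSpace ℝ (Fin m)

/-- The signs `(1, 1, -1, -1)` of a neutral metric of rank `4`. -/
def sgn : Fin 4 → ℝ := ![1, 1, -1, -1]

/-! ### Differential forms of degree one on `ℝᵐ` -/

/-- The exterior derivative of a `1`-form, evaluated on two vectors. -/
def dOne {m : ℕ} (α : Base m → Base m →L[ℝ] ℝ) (x v w : Base m) : ℝ :=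
  extDeriv (fun y => ContinuousAlternatingMap.ofSubsingleton ℝ (Base m) ℝ (0 : Fin 1) (α y)) x
    ![v, w]

/-- The wedge product of two `1`-forms, evaluated on two vectors. -/
def wedgeOne {m : ℕ} (α β : Base m → Base m →L[ℝ] ℝ) (x v w : Base m) : ℝ :=
  α x v * β x w - α x w * β x v

section VectorBundle

variable {m : ℕ} {F : Type u} [NormedAddCommGroup F] [NormedSpace ℝ F]
  {V : Base m → Type v} [TopologicalSpace (TotalSpace F V)]
  [∀ x, AddCommGroup (V x)] [∀ x, Module ℝ (V x)] [∀ x, TopologicalSpace (V x)]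
  [∀ x, IsTopologicalAddGroup (V x)] [∀ x, ContinuousSMul ℝ (V x)]
  [FiberBundle F V] [VectorBundle ℝ F V]

variable (F) in
/-- `σ` is a smooth section of the bundle `V` on the set `U`. -/
def SmoothSectionOn (σ : Π x, V x) (U : Set (Base m)) : Prop :=
  ContMDiffOn 𝓘(ℝ, Base m) (𝓘(ℝ, Base m).prod 𝓘(ℝ, F)) ∞ (fun x => TotalSpace.mk' F x (σ x)) U

variable (F) in
/-- `σ` is differentiable at `x` as a section of the bundle `V`. -/
def DiffSectionAt (σ : Π x, V x) (x : Base m) : Prop :=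
  MDifferentiableAt 𝓘(ℝ, Base m) (𝓘(ℝ, Base m).prod 𝓘(ℝ, F)) (fun y => TotalSpace.mk' F y (σ y)) x

variable (F V) in
/-- A smooth neutral metric of a vector bundle of rank `4`: a smooth field of symmetric bilinear
forms of signature `(2, 2)`. -/
structure NeutralMetric where
  /-- The bilinear form in each fibre. -/
  inner (x : Base m) : V x →L[ℝ] V x →L[ℝ] ℝ
  symm (x : Base m) (v w : V x) : inner x v w = inner x w v
  neutral (x : Base m) : ∃ b : Basis (Fin 4) ℝ (V x),
    ∀ i j, inner x (b i) (b j) = if i = j then sgn i else 0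
  smooth : ContMDiff 𝓘(ℝ, Base m) (𝓘(ℝ, Base m).prod 𝓘(ℝ, F →L[ℝ] F →L[ℝ] ℝ)) ∞
    (fun x => TotalSpace.mk' (F →L[ℝ] F →L[ℝ] ℝ) x (inner x))

variable (F V) in
/-- An orientation of a vector bundle of rank `4`: an orientation of each fibre such that near
each point there is a smooth local frame field giving it. -/
structure BundleOrientation where
  /-- The orientation of each fibre. -/
  fibre (x : Base m) : Orientation ℝ (V x) (Fin 4)
  locally_frame (x : Base m) : ∃ (U : Set (Base m)) (s : Fin 4 → Π y, V y)
    (hs : IsLocalFrameOn 𝓘(ℝ, Base m) F ∞ s U), IsOpen U ∧ x ∈ U ∧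
      ∀ y (hy : y ∈ U), (hs.toBasisAt hy).orientation = fibre y

/-- `e = (e₁, e₂, e₃, e₄)` is a smooth ordered pseudo-orthonormal frame field on `U` giving the
orientation, with `e₁, e₂` space-like and `e₃, e₄` time-like. -/
structure IsFrameOn (h : NeutralMetric F V) (o : BundleOrientation F V)
    (e : Fin 4 → Π x, V x) (U : Set (Base m)) : Prop where
  frame : IsLocalFrameOn 𝓘(ℝ, Base m) F ∞ e U
  orthonormal : ∀ x ∈ U, ∀ i j, h.inner x (e i x) (e j x) = if i = j then sgn i else 0
  oriented : ∀ x (hx : x ∈ U), (frame.toBasisAt hx).orientation = o.fibre x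

/-! ### Connections -/

/-- `∇` is an `h`-connection: a smooth connection with `∇h = 0`. -/
structure IsHConnection (h : NeutralMetric F V) (cov : CovariantDerivative 𝓘(ℝ, Base m) F V) :
    Prop where
  smooth : ContMDiffCovariantDerivativeOn F ∞ cov.toFun Set.univ
  metric : ∀ (σ τ : Π x, V x) (x : Base m), DiffSectionAt F σ x → DiffSectionAt F τ x →
    ∀ v : TangentSpace 𝓘(ℝ, Base m) x,
      fderiv ℝ (fun y => h.inner y (σ y) (τ y)) x v
        = h.inner x (cov σ x v) (τ x) + h.inner x (σ x) (cov τ x v)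

/-- `R(X, Y)σ = ∇_X ∇_Y σ - ∇_Y ∇_X σ - ∇_[X, Y] σ`. -/
def curvature (cov : CovariantDerivative 𝓘(ℝ, Base m) F V)
    (X Y : Π x : Base m, TangentSpace 𝓘(ℝ, Base m) x) (σ : Π x, V x) (x : Base m) : V x :=
  cov (fun y => cov σ y (Y y)) x (X x) - cov (fun y => cov σ y (X y)) x (Y x)
    - cov σ x (VectorField.mlieBracket 𝓘(ℝ, Base m) X Y x)

/-- The curvature tensor vanishes. -/
def IsFlat (cov : CovariantDerivative 𝓘(ℝ, Base m) F V) : Prop :=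
  ∀ (X Y : Π x : Base m, TangentSpace 𝓘(ℝ, Base m) x) (σ : Π x, V x),
    SmoothSectionOn (Base m) X Set.univ → SmoothSectionOn (Base m) Y Set.univ →
    SmoothSectionOn F σ Set.univ → ∀ x, curvature cov X Y σ x = 0

/-- The connection form `ω = [ωⁱⱼ]` of `∇` with respect to a global frame field `e`, that is,
`∇eⱼ = ∑ᵢ ωⁱⱼ ⊗ eᵢ`. Here `ωⁱⱼ` is `connForm cov he (i - 1) (j - 1)`. -/
def connForm {e : Fin 4 → Π x, V x} (cov : CovariantDerivative 𝓘(ℝ, Base m) F V)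
    (he : IsLocalFrameOn 𝓘(ℝ, Base m) F ∞ e Set.univ) (i j : Fin 4) (x : Base m) :
    Base m →L[ℝ] ℝ :=
  LinearMap.toContinuousLinearMap (E := Base m)
    ((he.coeff i x) ∘ₗ (cov (e j) x : TangentSpace 𝓘(ℝ, Base m) x →ₗ[ℝ] V x))

/-! ### The bundle of bivectors -/

/-- The bivector `a ∧ b`. -/
def wedge {W : Type*} [AddCommGroup W] [Module ℝ W] (a b : W) : ⋀[ℝ]^2 W :=
  exteriorPower.ιMulti ℝ 2 ![a, b]

/-- The metric `ĥ` of `⋀²V` induced by `h`, given by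
`ĥ(a ∧ b, c ∧ d) = h(a, c) h(b, d) - h(a, d) h(b, c)`. -/
def bivectorMetric (h : NeutralMetric F V) (x : Base m) (θ η : ⋀[ℝ]^2 (V x)) : ℝ :=
  exteriorPower.pairingDual ℝ (V x) 2
    (exteriorPower.map 2 (h.inner x).toLinearMap₁₂ θ) η

/-- The connection `∇̂` of `⋀²V` induced by `∇`. With respect to the local frame `s` of the
preferred trivialization at `x`, if `Ω = (1/2) ∑ᵢⱼ cᵢⱼ sᵢ ∧ sⱼ` with `cᵢⱼ = (sⁱ ∧ sʲ)(Ω)`, then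
`∇̂Ω = (1/2) ∑ᵢⱼ (dcᵢⱼ ⊗ sᵢ ∧ sⱼ + cᵢⱼ (∇sᵢ ∧ sⱼ + sᵢ ∧ ∇sⱼ))`. -/
def bivectorConn [FiniteDimensional ℝ F] [ContMDiffVectorBundle 1 F V 𝓘(ℝ, Base m)]
    (cov : CovariantDerivative 𝓘(ℝ, Base m) F V)
    (Ω : Π x, ⋀[ℝ]^2 (V x)) (x : Base m) (v : TangentSpace 𝓘(ℝ, Base m) x) : ⋀[ℝ]^2 (V x) :=
  let t := trivializationAt F V x
  let b := Module.finBasis ℝ F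
  let s := t.localFrame b
  let c := fun (i j : Fin (finrank ℝ F)) (y : Base m) =>
    exteriorPower.pairingDual ℝ (V y) 2
      (wedge (W := Module.Dual ℝ (V y)) (t.localFrameCoeff 𝓘(ℝ, Base m) b i y)
        (t.localFrameCoeff 𝓘(ℝ, Base m) b j y)) (Ω y)
  (1 / 2 : ℝ) • ∑ i, ∑ j,
    (fderiv ℝ (c i j) x v • wedge (s i x) (s j x)
      + c i j x • (wedge (cov (s i) x v) (s j x) + wedge (s i x) (cov (s j) x v)))

/-- `∇̂Ω` is fully light-like: it is light-like or zero, that is, every `∇̂_v Ω` is a null vector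
of `ĥ`, and it does not vanish at any point. -/
def FullyLightLike [FiniteDimensional ℝ F] [ContMDiffVectorBundle 1 F V 𝓘(ℝ, Base m)]
    (h : NeutralMetric F V) (cov : CovariantDerivative 𝓘(ℝ, Base m) F V)
    (Ω : Π x, ⋀[ℝ]^2 (V x)) : Prop :=
  ∀ x, (∀ v, bivectorMetric h x (bivectorConn cov Ω x v) (bivectorConn cov Ω x v) = 0) ∧
    ∃ v, bivectorConn cov Ω x v ≠ 0

/-- `Ω_{δ,1} = (e₁ ∧ e₂ + δ e₃ ∧ e₄) / √2`, for `δ = ±1`. -/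
def Omega1 (δ : ℝ) (e : Fin 4 → Π x, V x) (x : Base m) : ⋀[ℝ]^2 (V x) :=
  (1 / √2) • (wedge (e 0 x) (e 1 x) + δ • wedge (e 2 x) (e 3 x))

/-- `Ω_{δ,2} = (e₁ ∧ e₃ + δ e₄ ∧ e₂) / √2`, for `δ = ±1`. -/
def Omega2 (δ : ℝ) (e : Fin 4 → Π x, V x) (x : Base m) : ⋀[ℝ]^2 (V x) :=
  (1 / √2) • (wedge (e 0 x) (e 2 x) + δ • wedge (e 3 x) (e 1 x))

/-- `Ω_{δ,3} = (e₁ ∧ e₄ + δ e₂ ∧ e₃) / √2`, for `δ = ±1`. -/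
def Omega3 (δ : ℝ) (e : Fin 4 → Π x, V x) (x : Base m) : ⋀[ℝ]^2 (V x) :=
  (1 / √2) • (wedge (e 0 x) (e 3 x) + δ • wedge (e 1 x) (e 2 x))

/-- `Ω₀ = Ω_{-ε,1} + μ Ω_{ε,3}`. -/
def Omega0 (ε μ : ℝ) (e : Fin 4 → Π x, V x) (x : Base m) : ⋀[ℝ]^2 (V x) :=
  Omega1 (-ε) e x + μ • Omega3 ε e x

/-! ### The relations for the connection form -/

/-- The `1`-forms `ωⁱⱼ = om (i - 1) (j - 1)` satisfy, with `E = exp (μ f)`,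
`ω⁴₁ = ε E dg - ε ω³₂`, `ω⁴₂ = ε ω³₁ - df`, `ω⁴₃ = μ E dg - ε ω²₁`, together with
`dω²₁ = 2 ω³₁ ∧ ω³₂ - E ω³₁ ∧ dg + ε ω³₂ ∧ df + ε E df ∧ dg`,
`dω³₁ = 2 ω²₁ ∧ ω³₂ - E ω²₁ ∧ dg + ε μ E ω³₂ ∧ dg`,
`dω³₂ = -2 ω²₁ ∧ ω³₁ + ε ω²₁ ∧ df - ε μ E ω³₁ ∧ dg + μ E df ∧ dg`,
and `f`, `g` are smooth, `dg` is nowhere zero, `μ = ±1`. -/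
structure ConnRelations (ε μ : ℝ) (f g : Base m → ℝ)
    (om : Fin 4 → Fin 4 → Base m → Base m →L[ℝ] ℝ) : Prop where
  sign : μ = 1 ∨ μ = -1
  smooth_f : ContDiff ℝ ∞ f
  smooth_g : ContDiff ℝ ∞ g
  dg_ne : ∀ x, fderiv ℝ g x ≠ 0
  rel41 : ∀ x, om 3 0 x = (ε * Real.exp (μ * f x)) • fderiv ℝ g x - ε • om 2 1 x
  rel42 : ∀ x, om 3 1 x = ε • om 2 0 x - fderiv ℝ f x
  rel43 : ∀ x, om 3 2 x = (μ * Real.exp (μ * f x)) • fderiv ℝ g x - ε • om 1 0 x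
  d21 : ∀ x v w, dOne (om 1 0) x v w =
    2 * wedgeOne (om 2 0) (om 2 1) x v w
      - Real.exp (μ * f x) * wedgeOne (om 2 0) (fderiv ℝ g) x v w
      + ε * wedgeOne (om 2 1) (fderiv ℝ f) x v w
      + ε * Real.exp (μ * f x) * wedgeOne (fderiv ℝ f) (fderiv ℝ g) x v w
  d31 : ∀ x v w, dOne (om 2 0) x v w =
    2 * wedgeOne (om 1 0) (om 2 1) x v w
      - Real.exp (μ * f x) * wedgeOne (om 1 0) (fderiv ℝ g) x v w
      + ε * μ * Real.exp (μ * f x) * wedgeOne (om 2 1) (fderiv ℝ g) x v w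
  d32 : ∀ x v w, dOne (om 2 1) x v w =
    -2 * wedgeOne (om 1 0) (om 2 0) x v w
      + ε * wedgeOne (om 1 0) (fderiv ℝ f) x v w
      - ε * μ * Real.exp (μ * f x) * wedgeOne (om 2 0) (fderiv ℝ g) x v w
      + μ * Real.exp (μ * f x) * wedgeOne (fderiv ℝ f) (fderiv ℝ g) x v w

/-! ### Paracomplex structures -/

/-- `J` is an `ε`-paracomplex structure: a paracomplex structure that is `h`-reversing and, near
each point, is given by `Je₁ = e₃`, `Je₂ = -ε e₄`, `Je₃ = e₁`, `Je₄ = -ε e₂` for a smooth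
pseudo-orthonormal frame field giving the orientation. -/
structure IsParacomplex (h : NeutralMetric F V) (o : BundleOrientation F V) (ε : ℝ)
    (J : Π x, V x →ₗ[ℝ] V x) : Prop where
  sq : ∀ x a, J x (J x a) = a
  eigen_pos : ∀ x, finrank ℝ (Module.End.eigenspace (J x) 1) = 2
  eigen_neg : ∀ x, finrank ℝ (Module.End.eigenspace (J x) (-1)) = 2
  reversing : ∀ x a b, h.inner x (J x a) (J x b) = -h.inner x a b
  admissible : ∀ x, ∃ (U : Set (Base m)) (e : Fin 4 → Π y, V y),
    IsOpen U ∧ x ∈ U ∧ IsFrameOn h o e U ∧ ∀ y ∈ U,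
      J y (e 0 y) = e 2 y ∧ J y (e 1 y) = -ε • e 3 y ∧
      J y (e 2 y) = e 0 y ∧ J y (e 3 y) = -ε • e 1 y

/-- `J` corresponds to the bivector field `Ω`: `h(Ja, b) = √2 ĥ(Ω, a ∧ b)`. For
`Ω = Ω_{ε,2}` this means `Je₁ = e₃`, `Je₂ = -ε e₄`, `Je₃ = e₁`, `Je₄ = -ε e₂`. -/
def Corresponds (h : NeutralMetric F V) (J : Π x, V x →ₗ[ℝ] V x) (Ω : Π x, ⋀[ℝ]^2 (V x)) : Prop :=
  ∀ x a b, h.inner x (J x a) b = √2 * bivectorMetric h x (Ω x) (wedge a b)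

/-- `𝒟_J`, spanned at each point by the values `(∇_v J)σ = ∇_v (Jσ) - J(∇_v σ)` of `∇J`. -/
def distOf (cov : CovariantDerivative 𝓘(ℝ, Base m) F V) (J : Π x, V x →ₗ[ℝ] V x) (x : Base m) :
    Submodule ℝ (V x) :=
  Submodule.span ℝ {w | ∃ σ : Π y, V y, SmoothSectionOn F σ Set.univ ∧
    ∃ v : TangentSpace 𝓘(ℝ, Base m) x,
      w = cov (fun y => J y (σ y)) x v - J x (cov σ x v)}

end VectorBundle

/-! ### The neutral space `E⁴₂` -/

/-- The tangent bundle of `ℝ⁴`. -/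
abbrev T4 (x : Base 4) : Type := TangentSpace 𝓘(ℝ, Base 4) x

/-- The bilinear form `v₁w₁ + v₂w₂ - v₃w₃ - v₄w₄` on `ℝ⁴`. -/
def form42 : Base 4 →L[ℝ] Base 4 →L[ℝ] ℝ :=
  ∑ i, sgn i • ContinuousLinearMap.smulRight (EuclideanSpace.proj i : Base 4 →L[ℝ] ℝ)
    (EuclideanSpace.proj i : Base 4 →L[ℝ] ℝ)

theorem form42_apply (v w : Base 4) : form42 v w = ∑ i, sgn i * (v i * w i) := by
  simp [form42]

theorem form42_symm (v w : Base 4) : form42 v w = form42 w v := by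
  simp only [form42_apply, mul_comm]

theorem form42_neutral : ∃ b : Basis (Fin 4) ℝ (Base 4),
    ∀ i j, form42 (b i) (b j) = if i = j then sgn i else 0 := by
  refine ⟨(EuclideanSpace.basisFun (Fin 4) ℝ).toBasis, fun i j => ?_⟩
  rw [form42_apply]
  fin_cases i <;> fin_cases j <;> simp

/-- A constant field of bilinear forms on the tangent spaces of a vector space. -/
def constField {E : Type*} [NormedAddCommGroup E] [NormedSpace ℝ E] (c : E →L[ℝ] E →L[ℝ] ℝ)
    (x : E) : TangentSpace 𝓘(ℝ, E) x →L[ℝ] TangentSpace 𝓘(ℝ, E) x →L[ℝ] ℝ := c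

theorem contMDiff_constField {E : Type*} [NormedAddCommGroup E] [NormedSpace ℝ E]
    (c : E →L[ℝ] E →L[ℝ] ℝ) :
    ContMDiff 𝓘(ℝ, E) (𝓘(ℝ, E).prod 𝓘(ℝ, E →L[ℝ] E →L[ℝ] ℝ)) ∞
      (fun x => TotalSpace.mk' (E →L[ℝ] E →L[ℝ] ℝ) x (constField c x)) := by
  intro x
  rw [contMDiffAt_section]
  convert! contMDiffAt_const (c := c)
  ext v w
  rename_i y
  rw [hom_trivializationAt_apply]
  have hx (y : E) : y ∈ (trivializationAt E
    (fun x : E => TangentSpace 𝓘(ℝ, E) x) x).baseSet := by simp [chartAt_self_eq]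
  erw [inCoordinates_apply_eq₂ (hx _) (hx _) (Set.mem_univ _)]
  have h (v : E) : (trivializationAt E (TangentSpace 𝓘(ℝ, E)) x).symm y v = v :=
    (Trivialization.symmL_apply (R := ℝ) (trivializationAt E (TangentSpace 𝓘(ℝ, E)) x)
      (hx y) v).symm.trans (congrArg (fun L : E →L[ℝ] E => L v)
        (TangentBundle.symmL_model_space (𝕜 := ℝ) x y))
  simp [h]
  rfl

/-- The metric of `E⁴₂`. -/
def metricE42 : NeutralMetric (Base 4) T4 where
  inner := constField form42
  symm _ v w := form42_symm v w
  neutral _ := form42_neutral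
  smooth := contMDiff_constField form42

/-- `∇` is the Levi-Civita connection of `h`: a torsion-free `h`-connection. -/
structure IsLeviCivita (h : NeutralMetric (Base 4) T4)
    (cov : CovariantDerivative 𝓘(ℝ, Base 4) (Base 4) T4) : Prop where
  hconn : IsHConnection h cov
  torsion : cov.torsion = 0

/-- `(ℝ⁴, h, D)` is a Walker manifold, where `∇` is the Levi-Civita connection of `h`: `D` is a
smooth light-like two-dimensional distribution and the covariant derivatives of local sections
of `D` by any tangent vector are contained in `D`. -/
structure IsWalker (h : NeutralMetric (Base 4) T4)
    (cov : CovariantDerivative 𝓘(ℝ, Base 4) (Base 4) T4) (D : Π x, Submodule ℝ (T4 x)) :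
    Prop where
  rank : ∀ x, finrank ℝ (D x) = 2
  lightlike : ∀ x, ∀ a ∈ D x, ∀ b ∈ D x, h.inner x a b = 0
  smooth : ∀ x, ∃ (U : Set (Base 4)) (s : Fin 2 → Π y, T4 y), IsOpen U ∧ x ∈ U ∧
    (∀ i, SmoothSectionOn (Base 4) (s i) U) ∧
    ∀ y ∈ U, D y = Submodule.span ℝ (Set.range fun i => s i y)
  parallel : ∀ (U : Set (Base 4)) (σ : Π y, T4 y), IsOpen U → SmoothSectionOn (Base 4) σ U →
    (∀ y ∈ U, σ y ∈ D y) → ∀ x ∈ U, ∀ v, cov σ x v ∈ D x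

end FlatNeutral

end

open FlatNeutral

/-!
The connection `∇̂` preserves the splitting of `⋀²E` into its self-dual and anti-self-dual parts,
and the part containing `Ω_{ε,2}` has the orthogonal frame `Ω_{-ε,1}`, `Ω_{ε,2}`, `Ω_{ε,3}`, whose
squares with respect to `ĥ` are `1`, `-1`, `-1`. With `A = ε ω⁴₁ + ω³₂`, `B = ω⁴₃ + ε ω²₁` and
`P = ω⁴₂ - ε ω³₁`, the Leibniz rule for `∇̂` gives
`∇̂Ω_{ε,2} = A ⊗ Ω_{-ε,1} + B ⊗ Ω_{ε,3}`, `∇̂Ω_{-ε,1} = A ⊗ Ω_{ε,2} + P ⊗ Ω_{ε,3}` and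
`∇̂Ω_{ε,3} = P ⊗ Ω_{-ε,1} - B ⊗ Ω_{ε,2}` (`bivectorConn_Omega2`, `bivectorConn_Omega1`,
`bivectorConn_Omega3`), and `ĥ(∇̂_v Ω_{ε,2}, ∇̂_v Ω_{ε,2}) = A(v)² - B(v)²`.

Hence `∇̂Ω_{ε,2}` is fully light-like exactly when `A` vanishes nowhere and `B = ± A` at each point;
the sign `μ` is constant since `ℝᵐ` is connected (`exists_sign`). Flatness of `∇` says that
`dP = A ∧ B` and `dA = -P ∧ B`. For `B = μ A` the form `P` is closed, so `P = -df`, and then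
`exp (-μ f) A` is closed, so `A = exp (μ f) dg` by the Poincaré lemma (`exists_potentials`). The
relations `A = exp (μ f) dg`, `B = μ A`, `P = -df` are the three algebraic relations of
`ConnRelations`; given these, the three differential ones are three of the structure equations of
the flat connection `∇` (`connRelations_of_forms`).

The field `Ω₀ = Ω_{-ε,1} + μ Ω_{ε,3}` satisfies `∇̂Ω₀ = μ P ⊗ Ω₀ = -μ df ⊗ Ω₀`, so `exp (μ f) Ω₀` is
horizontal. A simultaneous boost in the planes of `e₁, e₃` and of `e₂, e₄` fixes `Ω_{ε,2}` and
rescales `Ω₀`, and with a suitable angle it rescales it by `exp (μ f)`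
(`ConnRelations.exists_horizontal_frame`).

On `E⁴₂` the Levi-Civita connection is the ordinary derivative, so it is flat
(`IsLeviCivita.isFlat`). The endomorphism field `J` corresponding to `Ω_{ε,2}` is determined by the
frame (`corresponds_iff`). The bivector `Ω₀` is, up to a factor, the exterior product of the null
vectors `e₁ - εμ e₃` and `e₂ + μ e₄`, and `∇J` is, up to a factor, `A` times the skew-symmetric
endomorphism corresponding to `Ω₀`; its image is the light-like plane of these two vectors
(`distOf_paraJ`). As `Ω₀` is recurrent, this plane field is parallel (`cov_mem_of_mem`).
-/

noncomputable section

set_option linter.unusedSectionVars false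

namespace FlatNeutral

section VectorBundle

variable {m : ℕ} {F : Type u} [NormedAddCommGroup F] [NormedSpace ℝ F]
  {V : Base m → Type v} [TopologicalSpace (TotalSpace F V)]
  [∀ x, AddCommGroup (V x)] [∀ x, Module ℝ (V x)] [∀ x, TopologicalSpace (V x)]
  [∀ x, IsTopologicalAddGroup (V x)] [∀ x, ContinuousSMul ℝ (V x)]
  [FiberBundle F V] [VectorBundle ℝ F V]

/-! ### Sections, metrics and frames -/

theorem SmoothSectionOn.diffSectionAt {σ : Π x, V x} {U : Set (Base m)}
    (hσ : SmoothSectionOn F σ U) {x : Base m} (hU : U ∈ 𝓝 x) : DiffSectionAt F σ x :=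
  (hσ.contMDiffAt hU).mdifferentiableAt (by simp)

theorem DiffSectionAt.add {σ τ : Π x, V x} {x : Base m} (hσ : DiffSectionAt F σ x)
    (hτ : DiffSectionAt F τ x) : DiffSectionAt F (fun y => σ y + τ y) x :=
  mdifferentiableAt_add_section hσ hτ

theorem DiffSectionAt.smul {c : Base m → ℝ} {σ : Π x, V x} {x : Base m}
    (hc : DifferentiableAt ℝ c x) (hσ : DiffSectionAt F σ x) :
    DiffSectionAt F (fun y => c y • σ y) x :=
  MDifferentiableAt.smul_section hc.mdifferentiableAt hσ

theorem DiffSectionAt.sum {ι : Type*} [Fintype ι] {σ : ι → Π x, V x} {x : Base m}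
    (hσ : ∀ i, DiffSectionAt F (σ i) x) : DiffSectionAt F (fun y => ∑ i, σ i y) x :=
  MDifferentiableAt.sum_section fun i _ => hσ i

theorem SmoothSectionOn.smul {c : Base m → ℝ} {σ : Π x, V x} {U : Set (Base m)}
    (hc : ContDiffOn ℝ ∞ c U) (hσ : SmoothSectionOn F σ U) :
    SmoothSectionOn F (fun y => c y • σ y) U :=
  ContMDiffOn.smul_section hc.contMDiffOn hσ

theorem SmoothSectionOn.add {σ τ : Π x, V x} {U : Set (Base m)}
    (hσ : SmoothSectionOn F σ U) (hτ : SmoothSectionOn F τ U) :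
    SmoothSectionOn F (fun y => σ y + τ y) U :=
  ContMDiffOn.add_section hσ hτ

namespace NeutralMetric

variable (h : NeutralMetric F V)

theorem contDiffOn_inner {σ τ : Π x, V x} {U : Set (Base m)}
    (hσ : SmoothSectionOn F σ U) (hτ : SmoothSectionOn F τ U) :
    ContDiffOn ℝ ∞ (fun y => h.inner y (σ y) (τ y)) U := by
  have : ContMDiffOn 𝓘(ℝ, Base m) (𝓘(ℝ, Base m).prod 𝓘(ℝ)) ∞
      (fun y => TotalSpace.mk' ℝ (E := Bundle.Trivial (Base m) ℝ) y
        (h.inner y (σ y) (τ y))) U := by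
    apply ContMDiffOn.clm_bundle_apply₂ (F₁ := F) (F₂ := F)
    · exact h.smooth.contMDiffOn
    · exact hσ
    · exact hτ
  rw [← contMDiffOn_iff_contDiffOn]
  intro x hx
  have h2 := this x hx
  simp only [contMDiffWithinAt_totalSpace] at h2
  exact h2.2

theorem differentiableAt_inner {σ τ : Π x, V x} {x : Base m}
    (hσ : DiffSectionAt F σ x) (hτ : DiffSectionAt F τ x) :
    DifferentiableAt ℝ (fun y => h.inner y (σ y) (τ y)) x := by
  have : MDifferentiableAt 𝓘(ℝ, Base m) (𝓘(ℝ, Base m).prod 𝓘(ℝ))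
      (fun y => TotalSpace.mk' ℝ (E := Bundle.Trivial (Base m) ℝ) y
        (h.inner y (σ y) (τ y))) x := by
    apply MDifferentiableAt.clm_bundle_apply₂ (F₁ := F) (F₂ := F)
    · exact (h.smooth.contMDiffAt).mdifferentiableAt (by simp)
    · exact hσ
    · exact hτ
  rw [← mdifferentiableAt_iff_differentiableAt]
  simp only [mdifferentiableAt_totalSpace] at this
  exact this.2

end NeutralMetric

theorem sgn_mul_self (i : Fin 4) : sgn i * sgn i = 1 := by
  fin_cases i <;> simp [sgn]

namespace IsFrameOn

variable {h : NeutralMetric F V} {o : BundleOrientation F V} {e : Fin 4 → Π x, V x}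
  {U : Set (Base m)}

theorem smoothSectionOn (he : IsFrameOn h o e U) (i : Fin 4) : SmoothSectionOn F (e i) U :=
  he.frame.contMDiffOn i

theorem eq_sum_coeff (he : IsFrameOn h o e U) {x : Base m} (hx : x ∈ U) (w : V x) :
    w = ∑ i, he.frame.coeff i x w • e i x := by
  simpa [IsLocalFrameOn.coeff, hx] using (Basis.sum_repr (he.frame.toBasisAt hx) w).symm

theorem coeff_eq (he : IsFrameOn h o e U) {x : Base m} (hx : x ∈ U) (i : Fin 4) (w : V x) :
    he.frame.coeff i x w = sgn i * h.inner x w (e i x) := by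
  conv_rhs => rw [he.eq_sum_coeff hx w]
  simp only [map_sum, map_smul, sum_apply, smul_apply,
    he.orthonormal x hx, smul_eq_mul, mul_ite, mul_zero, Finset.sum_ite_eq', Finset.mem_univ,
    if_true]
  rw [mul_left_comm, sgn_mul_self, mul_one]

theorem coeff_frame (he : IsFrameOn h o e U) {x : Base m} (hx : x ∈ U) (i j : Fin 4) :
    he.frame.coeff i x (e j x) = if i = j then 1 else 0 := by
  rw [he.coeff_eq hx, he.orthonormal x hx]
  by_cases hij : i = j
  · simp [hij, sgn_mul_self]
  · simp [hij, Ne.symm hij]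

/-- A vector is determined by its inner products with a frame. -/
theorem ext_inner (he : IsFrameOn h o e U) {x : Base m} (hx : x ∈ U) {w w' : V x}
    (hw : ∀ i, h.inner x w (e i x) = h.inner x w' (e i x)) : w = w' := by
  rw [he.eq_sum_coeff hx w, he.eq_sum_coeff hx w']
  simp only [he.coeff_eq hx, hw]

theorem contDiffOn_coeff (he : IsFrameOn h o e U) {σ : Π x, V x} (hσ : SmoothSectionOn F σ U)
    (i : Fin 4) : ContDiffOn ℝ ∞ (fun y => he.frame.coeff i y (σ y)) U := by
  refine ContDiffOn.congr (f := fun y => sgn i * h.inner y (σ y) (e i y)) ?_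
    fun y hy => he.coeff_eq hy i (σ y)
  exact contDiffOn_const.mul (h.contDiffOn_inner hσ (he.smoothSectionOn i))

theorem diffSectionAt (he : IsFrameOn h o e Set.univ) (i : Fin 4) (x : Base m) :
    DiffSectionAt F (e i) x :=
  (he.smoothSectionOn i).diffSectionAt Filter.univ_mem

theorem differentiableAt_coeff (he : IsFrameOn h o e Set.univ) {σ : Π x, V x} {x : Base m}
    (hσ : DiffSectionAt F σ x) (i : Fin 4) :
    DifferentiableAt ℝ (fun y => he.frame.coeff i y (σ y)) x := by
  have : (fun y => he.frame.coeff i y (σ y)) = fun y => sgn i * h.inner y (σ y) (e i y) :=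
    funext fun y => he.coeff_eq (Set.mem_univ y) i (σ y)
  rw [this]
  exact (h.differentiableAt_inner hσ (he.diffSectionAt i x)).const_mul _

end IsFrameOn

/-! ### Covariant derivatives and the connection form -/

section Cov

variable (cov : CovariantDerivative 𝓘(ℝ, Base m) F V)

theorem cov_add {σ τ : Π x, V x} {x : Base m} (hσ : DiffSectionAt F σ x)
    (hτ : DiffSectionAt F τ x) (v : TangentSpace 𝓘(ℝ, Base m) x) :
    cov (fun y => σ y + τ y) x v = cov σ x v + cov τ x v :=
  congrArg (fun L => L v) (cov.isCovariantDerivativeOnUniv.add hσ hτ)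

theorem cov_smul {c : Base m → ℝ} {σ : Π x, V x} {x : Base m}
    (hc : DifferentiableAt ℝ c x) (hσ : DiffSectionAt F σ x)
    (v : TangentSpace 𝓘(ℝ, Base m) x) :
    cov (fun y => c y • σ y) x v = c x • cov σ x v + fderiv ℝ c x v • σ x := by
  have := congrArg (fun L => L v)
    (cov.isCovariantDerivativeOnUniv.leibniz hσ hc.mdifferentiableAt)
  simpa [mvfderiv, mfderiv_eq_fderiv] using! this

theorem cov_const_smul (c : ℝ) {σ : Π x, V x} {x : Base m} (hσ : DiffSectionAt F σ x)
    (v : TangentSpace 𝓘(ℝ, Base m) x) : cov (fun y => c • σ y) x v = c • cov σ x v :=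
  congrArg (fun L => L v) (cov.isCovariantDerivativeOnUniv.smul_const c hσ)

theorem cov_zero (x : Base m) (v : TangentSpace 𝓘(ℝ, Base m) x) :
    cov (fun _ => 0) x v = 0 :=
  congrArg (fun L => L v) (cov.isCovariantDerivativeOnUniv.zero (x := x))

theorem cov_congr {σ τ : Π x, V x} {x : Base m} (hσ : DiffSectionAt F σ x)
    (hτ : DiffSectionAt F τ x) (hστ : ∀ᶠ y in 𝓝 x, σ y = τ y)
    (v : TangentSpace 𝓘(ℝ, Base m) x) : cov σ x v = cov τ x v :=
  congrArg (fun L => L v)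
    (cov.isCovariantDerivativeOnUniv.congr_of_eventuallyEq hσ hτ Filter.univ_mem hστ)

theorem cov_sum {ι : Type*} [Fintype ι] {σ : ι → Π x, V x} {x : Base m}
    (hσ : ∀ i, DiffSectionAt F (σ i) x) (v : TangentSpace 𝓘(ℝ, Base m) x) :
    cov (fun y => ∑ i, σ i y) x v = ∑ i, cov (σ i) x v := by
  classical
  have key : ∀ s : Finset ι, DiffSectionAt F (fun y => ∑ i ∈ s, σ i y) x ∧
      cov (fun y => ∑ i ∈ s, σ i y) x v = ∑ i ∈ s, cov (σ i) x v := by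
    intro s
    refine ⟨MDifferentiableAt.sum_section fun i _ => hσ i, ?_⟩
    induction s using Finset.induction_on with
    | empty => simpa using cov_zero cov x v
    | insert a s ha ih =>
      simp only [Finset.sum_insert ha]
      rw [cov_add cov (hσ a) (MDifferentiableAt.sum_section fun i _ => hσ i), ih]
  exact (key Finset.univ).2

variable {cov} {h : NeutralMetric F V} {o : BundleOrientation F V} {e : Fin 4 → Π x, V x}

theorem cov_frame (he : IsFrameOn h o e Set.univ) (j : Fin 4) (x v : Base m) :
    cov (e j) x v = ∑ i, connForm cov he.frame i j x v • e i x :=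
  he.eq_sum_coeff (Set.mem_univ x) _

/-- `∇σ = ∑ᵢ (σⁱ ∇eᵢ + dσⁱ ⊗ eᵢ)`. -/
theorem cov_eq_sum (he : IsFrameOn h o e Set.univ) {σ : Π x, V x} {x : Base m}
    (hσ : DiffSectionAt F σ x) (v : TangentSpace 𝓘(ℝ, Base m) x) :
    cov σ x v = ∑ i, (he.frame.coeff i x (σ x) • cov (e i) x v +
      fderiv ℝ (fun y => he.frame.coeff i y (σ y)) x v • e i x) := by
  have h1 : σ = fun y => ∑ i, he.frame.coeff i y (σ y) • e i y :=
    funext fun y => he.eq_sum_coeff (Set.mem_univ y) _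
  conv_lhs => rw [h1]
  rw [cov_sum cov fun i => (he.diffSectionAt i x).smul (he.differentiableAt_coeff hσ i)]
  refine Finset.sum_congr rfl fun i _ => ?_
  rw [cov_smul cov (he.differentiableAt_coeff hσ i) (he.diffSectionAt i x)]

theorem inner_cov_frame (he : IsFrameOn h o e Set.univ) (i j : Fin 4) (x v : Base m) :
    h.inner x (cov (e j) x v) (e i x) = sgn i * connForm cov he.frame i j x v := by
  have h1 : connForm cov he.frame i j x v = sgn i * h.inner x (cov (e j) x v) (e i x) :=
    he.coeff_eq (Set.mem_univ x) i _
  rw [h1, ← mul_assoc, sgn_mul_self, one_mul]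

/-- The connection form takes its values in `𝔰𝔬(2, 2)`. -/
theorem connForm_skew (hcov : IsHConnection h cov) (he : IsFrameOn h o e Set.univ)
    (i j : Fin 4) (x v : Base m) :
    sgn i * connForm cov he.frame i j x v + sgn j * connForm cov he.frame j i x v = 0 := by
  have h1 := hcov.metric (e j) (e i) x (he.diffSectionAt j x) (he.diffSectionAt i x) v
  have h2 : (fun y => h.inner y (e j y) (e i y)) = fun _ => if j = i then sgn j else 0 :=
    funext fun y => he.orthonormal y (Set.mem_univ y) j i
  rw [h2, h.symm x (e j x), inner_cov_frame he, inner_cov_frame he] at h1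
  simpa using h1.symm

/-- The constant vector field with value `w`. -/
def constVec (w : Base m) (x : Base m) : TangentSpace 𝓘(ℝ, Base m) x := w

theorem smoothSectionOn_vectorField {X : Π x : Base m, TangentSpace 𝓘(ℝ, Base m) x}
    {U : Set (Base m)} :
    SmoothSectionOn (Base m) X U ↔ ContDiffOn ℝ ∞ (X : Base m → Base m) U :=
  contMDiffOn_vectorSpace_iff_contDiffOn

theorem smoothSectionOn_constVec (w : Base m) (U : Set (Base m)) :
    SmoothSectionOn (Base m) (constVec w) U :=
  smoothSectionOn_vectorField.2 contDiffOn_const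

theorem smoothSectionOn_cov (hcov : IsHConnection h cov) {σ : Π x, V x}
    (hσ : SmoothSectionOn F σ Set.univ) (w : Base m) :
    SmoothSectionOn F (fun y => cov σ y (constVec w y)) Set.univ := by
  have h1 := hcov.smooth.contMDiff hσ
  exact ContMDiffOn.clm_bundle_apply (F₁ := Base m) (F₂ := F) h1
    (smoothSectionOn_constVec w Set.univ)

theorem contDiff_connForm (hcov : IsHConnection h cov) (he : IsFrameOn h o e Set.univ)
    (i j : Fin 4) : ContDiff ℝ ∞ (connForm cov he.frame i j) := by
  rw [contDiff_clm_apply_iff]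
  intro w
  exact contDiffOn_univ.1
    (he.contDiffOn_coeff (smoothSectionOn_cov hcov (he.smoothSectionOn j) w) i)

theorem dOne_apply {α : Base m → Base m →L[ℝ] ℝ} {x : Base m} (hα : DifferentiableAt ℝ α x)
    (v w : Base m) : dOne α x v w = fderiv ℝ α x v w - fderiv ℝ α x w v := by
  have h1 : DifferentiableAt ℝ (fun y => ContinuousAlternatingMap.ofSubsingleton ℝ (Base m) ℝ
      (0 : Fin 1) (α y)) x :=
    (ContinuousAlternatingMap.ofSubsingletonLIE (𝕜 := ℝ) (E := Base m) (F := ℝ)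
      (0 : Fin 1)).toContinuousLinearEquiv.differentiableAt.comp x hα
  rw [dOne, extDeriv_apply h1]
  have h2 : ∀ u : Base m, fderiv ℝ (fun y => α y u) x = (fderiv ℝ α x).flip u := by
    intro u
    ext z
    simp [fderiv_clm_apply hα (differentiableAt_const u)]
  simp [Fin.sum_univ_two, Fin.removeNth, Fin.succAbove, h2, sub_eq_add_neg]

theorem mlieBracket_constVec (v w x : Base m) :
    VectorField.mlieBracket 𝓘(ℝ, Base m) (constVec v) (constVec w) x = 0 := by
  rw [← VectorField.mlieBracketWithin_univ, VectorField.mlieBracketWithin_eq_lieBracketWithin]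
  change VectorField.lieBracketWithin ℝ (fun _ : Base m => v) (fun _ => w) Set.univ x = 0
  simp [VectorField.lieBracketWithin]

/-- The structure equation `dω + ω ∧ ω = 0` of a flat connection. -/
theorem dOne_connForm (hcov : IsHConnection h cov) (hflat : IsFlat cov)
    (he : IsFrameOn h o e Set.univ) (i j : Fin 4) (x v w : Base m) :
    dOne (connForm cov he.frame i j) x v w =
      -∑ k, wedgeOne (connForm cov he.frame i k) (connForm cov he.frame k j) x v w := by
  set om := connForm cov he.frame with hom
  have hd : ∀ i j, Differentiable ℝ (om i j) := fun i j =>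
    (contDiff_connForm hcov he i j).differentiable (by simp)
  have hsec : ∀ u : Base m, DiffSectionAt F (fun y => cov (e j) y (constVec u y)) x := fun u =>
    (smoothSectionOn_cov hcov (he.smoothSectionOn j) u).diffSectionAt Filter.univ_mem
  have key : ∀ a b : Base m,
      he.frame.coeff i x (cov (fun y => cov (e j) y (constVec b y)) x (constVec a x)) =
      fderiv ℝ (om i j) x a b + ∑ k, om i k x a * om k j x b := by
    intro a b
    have h1 : ∀ k, (fun y => he.frame.coeff k y (cov (e j) y (constVec b y))) =
        fun y => om k j y b := fun k => rfl
    have h2 : ∀ k, he.frame.coeff k x (cov (e j) x (constVec b x)) = om k j x b := fun k => rfl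
    have h4 : ∀ k, he.frame.coeff i x (cov (e k) x (constVec a x)) = om i k x a := fun k => rfl
    have h3 : ∀ k, fderiv ℝ (fun y => om k j y b) x (constVec a x) =
        fderiv ℝ (om k j) x a b := by
      intro k
      rw [fderiv_clm_apply (hd k j x) (differentiableAt_const b)]
      simp [constVec]
    rw [cov_eq_sum he (hsec b), map_sum]
    simp only [map_add, map_smul, he.coeff_frame (Set.mem_univ x), h1, h2, h3, h4, smul_eq_mul,
      Finset.sum_add_distrib, mul_ite, mul_one, mul_zero, Finset.sum_ite_eq, Finset.mem_univ,
      if_true]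
    rw [add_comm]
    simp only [mul_comm]
  have hR := hflat (constVec v) (constVec w) (e j) (smoothSectionOn_constVec v _)
    (smoothSectionOn_constVec w _) (he.smoothSectionOn j) x
  have h2 := congrArg (he.frame.coeff i x) hR
  simp only [curvature, mlieBracket_constVec, map_sub, map_zero, sub_zero] at h2
  rw [key, key] at h2
  rw [dOne_apply (hd i j x)]
  simp only [wedgeOne, Finset.sum_sub_distrib]
  linarith

end Cov

end VectorBundle

/-! ### Bivectors -/

section Wedge

variable {W : Type*} [AddCommGroup W] [Module ℝ W]

theorem wedge_add_left (a b c : W) : wedge (a + b) c = wedge a c + wedge b c := by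
  have := (exteriorPower.ιMulti ℝ 2 (M := W)).map_update_add ![a, c] 0 a b
  have hu : ∀ z, Function.update ![a, c] 0 z = ![z, c] := fun z => by
    ext i
    fin_cases i <;> simp
  rwa [hu, hu, hu] at this

theorem wedge_smul_left (r : ℝ) (a c : W) : wedge (r • a) c = r • wedge a c := by
  have := (exteriorPower.ιMulti ℝ 2 (M := W)).map_update_smul ![a, c] 0 r a
  have hu : ∀ z, Function.update ![a, c] 0 z = ![z, c] := fun z => by
    ext i
    fin_cases i <;> simp
  rwa [hu, hu] at this

theorem wedge_swap (a b : W) : wedge b a = -wedge a b := by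
  have := (exteriorPower.ιMulti ℝ 2 (M := W)).map_swap ![a, b] (i := 0) (j := 1) (by simp)
  rw [wedge, wedge, ← this]
  congr 1
  ext i
  fin_cases i <;> simp

theorem wedge_self (a : W) : wedge a a = 0 :=
  (exteriorPower.ιMulti ℝ 2 (M := W)).map_eq_zero_of_eq ![a, a] (i := 0) (j := 1) rfl (by simp)

theorem wedge_add_right (a b c : W) : wedge a (b + c) = wedge a b + wedge a c := by
  rw [wedge_swap, wedge_add_left, wedge_swap b a, wedge_swap c a]
  abel

theorem wedge_smul_right (r : ℝ) (a c : W) : wedge a (r • c) = r • wedge a c := by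
  rw [wedge_swap, wedge_smul_left, wedge_swap c a, smul_neg]

/-- The exterior product of two vectors as a bilinear map. -/
def wedgeₗ : W →ₗ[ℝ] W →ₗ[ℝ] ⋀[ℝ]^2 W :=
  LinearMap.mk₂ ℝ wedge wedge_add_left wedge_smul_left wedge_add_right wedge_smul_right

theorem wedgeₗ_apply (a b : W) : wedgeₗ a b = wedge a b := rfl

theorem wedge_sum_left {ι : Type*} (s : Finset ι) (a : ι → W) (b : W) :
    wedge (∑ i ∈ s, a i) b = ∑ i ∈ s, wedge (a i) b := by
  simp [← wedgeₗ_apply]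

theorem wedge_sum_right {ι : Type*} (s : Finset ι) (a : W) (b : ι → W) :
    wedge a (∑ i ∈ s, b i) = ∑ i ∈ s, wedge a (b i) := by
  simp [← wedgeₗ_apply]

theorem sum_sum_smul_wedge {ι : Type*} [Fintype ι] (p q : ι → ℝ) (a b : ι → W) :
    ∑ i, ∑ j, (p i * q j) • wedge (a i) (b j) = wedge (∑ i, p i • a i) (∑ j, q j • b j) := by
  rw [wedge_sum_left]
  refine Finset.sum_congr rfl fun i _ => ?_
  rw [wedge_sum_right]
  refine Finset.sum_congr rfl fun j _ => ?_
  rw [wedge_smul_left, wedge_smul_right, smul_smul]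

/-- The Leibniz rule for bivectors in coordinates: `p`, `q` are the coordinates of two vectors
with respect to vectors `sᵢ`, and `p'`, `q'`, `n` play the role of derivatives of `p`, `q`, `s`. -/
theorem half_sum_leibniz_wedge {ι : Type*} [Fintype ι] (p q p' q' : ι → ℝ) (s n : ι → W) :
    (1 / 2 : ℝ) • ∑ i, ∑ j,
      ((p i * q' j + p' i * q j - (q i * p' j + q' i * p j)) • wedge (s i) (s j)
        + (p i * q j - q i * p j) • (wedge (n i) (s j) + wedge (s i) (n j))) =
      wedge (∑ i, (p i • n i + p' i • s i)) (∑ i, q i • s i) +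
        wedge (∑ i, p i • s i) (∑ i, (q i • n i + q' i • s i)) := by
  have h1 : ∀ i j, (p i * q' j + p' i * q j - (q i * p' j + q' i * p j)) • wedge (s i) (s j)
        + (p i * q j - q i * p j) • (wedge (n i) (s j) + wedge (s i) (n j)) =
      (p i * q' j) • wedge (s i) (s j) + (p' i * q j) • wedge (s i) (s j)
        - (q i * p' j) • wedge (s i) (s j) - (q' i * p j) • wedge (s i) (s j)
        + (p i * q j) • wedge (n i) (s j) - (q i * p j) • wedge (n i) (s j)
        + (p i * q j) • wedge (s i) (n j) - (q i * p j) • wedge (s i) (n j) := fun i j => by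
    module
  simp only [h1, Finset.sum_add_distrib, Finset.sum_sub_distrib,
    sum_sum_smul_wedge, wedge_add_left, wedge_add_right]
  generalize ∑ i, p i • s i = A
  generalize ∑ i, q i • s i = B
  generalize ∑ i, p i • n i = A₁
  generalize ∑ i, q i • n i = B₁
  generalize ∑ i, p' i • s i = A₂
  generalize ∑ i, q' i • s i = B₂
  rw [wedge_swap A B₁, wedge_swap A₁ B, wedge_swap A B₂, wedge_swap A₂ B]
  module

end Wedge

theorem fderiv_fun_add_apply {E : Type*} [NormedAddCommGroup E] [NormedSpace ℝ E] {f g : E → ℝ}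
    {x : E} (hf : DifferentiableAt ℝ f x) (hg : DifferentiableAt ℝ g x) (v : E) :
    fderiv ℝ (fun y => f y + g y) x v = fderiv ℝ f x v + fderiv ℝ g x v := by
  rw [fderiv_fun_add hf hg, add_apply]

theorem fderiv_fun_sub_apply {E : Type*} [NormedAddCommGroup E] [NormedSpace ℝ E] {f g : E → ℝ}
    {x : E} (hf : DifferentiableAt ℝ f x) (hg : DifferentiableAt ℝ g x) (v : E) :
    fderiv ℝ (fun y => f y - g y) x v = fderiv ℝ f x v - fderiv ℝ g x v := by
  rw [fderiv_fun_sub hf hg, sub_apply]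

theorem fderiv_fun_mul_apply {E : Type*} [NormedAddCommGroup E] [NormedSpace ℝ E] {f g : E → ℝ}
    {x : E} (hf : DifferentiableAt ℝ f x) (hg : DifferentiableAt ℝ g x) (v : E) :
    fderiv ℝ (fun y => f y * g y) x v = f x * fderiv ℝ g x v + fderiv ℝ f x v * g x := by
  rw [fderiv_fun_mul hf hg]
  simp [mul_comm]

section VectorBundle

variable {m : ℕ} {F : Type u} [NormedAddCommGroup F] [NormedSpace ℝ F]
  {V : Base m → Type v} [TopologicalSpace (TotalSpace F V)]
  [∀ x, AddCommGroup (V x)] [∀ x, Module ℝ (V x)] [∀ x, TopologicalSpace (V x)]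
  [∀ x, IsTopologicalAddGroup (V x)] [∀ x, ContinuousSMul ℝ (V x)]
  [FiberBundle F V] [VectorBundle ℝ F V]

section Metric

variable (h : NeutralMetric F V) (x : Base m)

theorem bivectorMetric_add_left (θ θ' η : ⋀[ℝ]^2 (V x)) :
    bivectorMetric h x (θ + θ') η = bivectorMetric h x θ η + bivectorMetric h x θ' η := by
  simp [bivectorMetric]

theorem bivectorMetric_smul_left (r : ℝ) (θ η : ⋀[ℝ]^2 (V x)) :
    bivectorMetric h x (r • θ) η = r * bivectorMetric h x θ η := by
  simp [bivectorMetric]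

theorem bivectorMetric_add_right (θ η η' : ⋀[ℝ]^2 (V x)) :
    bivectorMetric h x θ (η + η') = bivectorMetric h x θ η + bivectorMetric h x θ η' := by
  simp [bivectorMetric]

theorem bivectorMetric_smul_right (r : ℝ) (θ η : ⋀[ℝ]^2 (V x)) :
    bivectorMetric h x θ (r • η) = r * bivectorMetric h x θ η := by
  simp [bivectorMetric]

theorem bivectorMetric_wedge (a b c d : V x) :
    bivectorMetric h x (wedge a b) (wedge c d) =
      h.inner x a c * h.inner x b d - h.inner x a d * h.inner x b c := by
  rw [bivectorMetric, wedge, wedge, exteriorPower.map_apply_ιMulti,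
    exteriorPower.pairingDual_ιMulti_ιMulti, Matrix.det_fin_two]
  simp
  ring

end Metric

/-! ### The induced connection on bivectors -/

section BivectorConn

variable [FiniteDimensional ℝ F] [ContMDiffVectorBundle ∞ F V 𝓘(ℝ, Base m)]

/-- The `i`-th coordinate in the local frame of the preferred trivialization at `x₀`, the one used
to define `bivectorConn` at `x₀`. -/
def locCoeff (F : Type u) [NormedAddCommGroup F] [NormedSpace ℝ F] (V : Base m → Type v)
    [TopologicalSpace (TotalSpace F V)]
    [∀ x, AddCommGroup (V x)] [∀ x, Module ℝ (V x)] [∀ x, TopologicalSpace (V x)]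
    [∀ x, IsTopologicalAddGroup (V x)] [∀ x, ContinuousSMul ℝ (V x)]
    [FiberBundle F V] [VectorBundle ℝ F V]
    [FiniteDimensional ℝ F] [ContMDiffVectorBundle ∞ F V 𝓘(ℝ, Base m)]
    (x₀ : Base m) (i : Fin (finrank ℝ F)) (y : Base m) : V y →ₗ[ℝ] ℝ :=
  (trivializationAt F V x₀).localFrameCoeff 𝓘(ℝ, Base m) (Module.finBasis ℝ F) i y

/-- The coordinate `sⁱ ∧ sʲ` of bivectors, where `s` is the local frame of the preferred
trivialization at `x₀`. -/
def bivCoeff (F : Type u) [NormedAddCommGroup F] [NormedSpace ℝ F] (V : Base m → Type v)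
    [TopologicalSpace (TotalSpace F V)]
    [∀ x, AddCommGroup (V x)] [∀ x, Module ℝ (V x)] [∀ x, TopologicalSpace (V x)]
    [∀ x, IsTopologicalAddGroup (V x)] [∀ x, ContinuousSMul ℝ (V x)]
    [FiberBundle F V] [VectorBundle ℝ F V]
    [FiniteDimensional ℝ F] [ContMDiffVectorBundle ∞ F V 𝓘(ℝ, Base m)]
    (x₀ : Base m) (i j : Fin (finrank ℝ F)) (y : Base m) : ⋀[ℝ]^2 (V y) →ₗ[ℝ] ℝ :=
  exteriorPower.pairingDual ℝ (V y) 2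
    (wedge (W := Module.Dual ℝ (V y)) (locCoeff F V x₀ i y) (locCoeff F V x₀ j y))

variable (F) in
/-- The local frame of the preferred trivialization at `x₀`. -/
def locFrame (x₀ : Base m) (i : Fin (finrank ℝ F)) (y : Base m) : V y :=
  (trivializationAt F V x₀).localFrame (Module.finBasis ℝ F) i y

variable (F) in
/-- `Ω` is differentiable at `x` as a field of bivectors: its coordinates are. -/
def DiffBivectorAt (Ω : Π x, ⋀[ℝ]^2 (V x)) (x : Base m) : Prop :=
  ∀ i j, DifferentiableAt ℝ (fun y => bivCoeff F V x i j y (Ω y)) x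

variable (cov : CovariantDerivative 𝓘(ℝ, Base m) F V)

theorem bivectorConn_eq (Ω : Π x, ⋀[ℝ]^2 (V x)) (x : Base m)
    (v : TangentSpace 𝓘(ℝ, Base m) x) :
    bivectorConn cov Ω x v = (1 / 2 : ℝ) • ∑ i, ∑ j,
      (fderiv ℝ (fun y => bivCoeff F V x i j y (Ω y)) x v •
          wedge (locFrame F x i x) (locFrame F x j x)
        + bivCoeff F V x i j x (Ω x) •
          (wedge (cov (locFrame F x i) x v) (locFrame F x j x) +
            wedge (locFrame F x i x) (cov (locFrame F x j) x v))) := rfl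

theorem bivCoeff_wedge (x₀ y : Base m) (i j : Fin (finrank ℝ F)) (a b : V y) :
    bivCoeff F V x₀ i j y (wedge a b) =
      locCoeff F V x₀ i y a * locCoeff F V x₀ j y b
        - locCoeff F V x₀ i y b * locCoeff F V x₀ j y a := by
  rw [bivCoeff, wedge, wedge, exteriorPower.pairingDual_ιMulti_ιMulti, Matrix.det_fin_two]
  simp
  ring

theorem differentiableAt_locCoeff {σ : Π x, V x} {x : Base m} (hσ : DiffSectionAt F σ x)
    (i : Fin (finrank ℝ F)) : DifferentiableAt ℝ (fun y => locCoeff F V x i y (σ y)) x :=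
  (mdifferentiableAt_localFrameCoeff (Module.finBasis ℝ F)
    (FiberBundle.mem_baseSet_trivializationAt' x) hσ i).differentiableAt

theorem diffSectionAt_locFrame (x : Base m) (i : Fin (finrank ℝ F)) :
    DiffSectionAt F (V := V) (locFrame F x i) x :=
  (contMDiffAt_localFrame_of_mem 1 (trivializationAt F V x) (Module.finBasis ℝ F) i
    (FiberBundle.mem_baseSet_trivializationAt' x)).mdifferentiableAt (by simp)

theorem eventually_eq_sum_locCoeff (σ : Π x, V x) (x : Base m) :
    ∀ᶠ y in 𝓝 x, σ y = ∑ i, locCoeff F V x i y (σ y) • locFrame F x i y :=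
  (trivializationAt F V x).eventually_eq_localFrame_sum_coeff_smul (Module.finBasis ℝ F)
    (FiberBundle.mem_baseSet_trivializationAt' x)

theorem cov_eq_sum_locFrame {σ : Π x, V x} {x : Base m} (hσ : DiffSectionAt F σ x)
    (v : TangentSpace 𝓘(ℝ, Base m) x) :
    cov σ x v = ∑ i, (locCoeff F V x i x (σ x) • cov (locFrame F x i) x v +
      fderiv ℝ (fun y => locCoeff F V x i y (σ y)) x v • locFrame F x i x) := by
  have hd := fun i => (diffSectionAt_locFrame (V := V) x i).smul (differentiableAt_locCoeff hσ i)
  rw [cov_congr cov hσ (DiffSectionAt.sum hd) (eventually_eq_sum_locCoeff σ x), cov_sum cov hd]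
  refine Finset.sum_congr rfl fun i _ => ?_
  rw [cov_smul cov (differentiableAt_locCoeff hσ i) (diffSectionAt_locFrame x i)]

theorem DiffBivectorAt.wedge {σ τ : Π x, V x} {x : Base m} (hσ : DiffSectionAt F σ x)
    (hτ : DiffSectionAt F τ x) : DiffBivectorAt F (fun y => wedge (σ y) (τ y)) x := by
  intro i j
  simp only [bivCoeff_wedge]
  exact ((differentiableAt_locCoeff hσ i).mul (differentiableAt_locCoeff hτ j)).sub
    ((differentiableAt_locCoeff hτ i).mul (differentiableAt_locCoeff hσ j))

theorem DiffBivectorAt.add {Ω Θ : Π x, ⋀[ℝ]^2 (V x)} {x : Base m} (hΩ : DiffBivectorAt F Ω x)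
    (hΘ : DiffBivectorAt F Θ x) : DiffBivectorAt F (fun y => Ω y + Θ y) x := by
  intro i j
  simp only [map_add]
  exact (hΩ i j).add (hΘ i j)

theorem DiffBivectorAt.smul {c : Base m → ℝ} {Ω : Π x, ⋀[ℝ]^2 (V x)} {x : Base m}
    (hc : DifferentiableAt ℝ c x) (hΩ : DiffBivectorAt F Ω x) :
    DiffBivectorAt F (fun y => c y • Ω y) x := by
  intro i j
  simp only [map_smul, smul_eq_mul]
  exact hc.mul (hΩ i j)

/-- Additivity requires differentiability, because `fderiv` of a coordinate is `0` where the
coordinate is not differentiable. -/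
theorem bivectorConn_add {Ω Θ : Π x, ⋀[ℝ]^2 (V x)} {x : Base m} (hΩ : DiffBivectorAt F Ω x)
    (hΘ : DiffBivectorAt F Θ x) (v : TangentSpace 𝓘(ℝ, Base m) x) :
    bivectorConn cov (fun y => Ω y + Θ y) x v =
      bivectorConn cov Ω x v + bivectorConn cov Θ x v := by
  simp only [bivectorConn_eq, ← smul_add, ← Finset.sum_add_distrib, map_add]
  congr 1
  refine Finset.sum_congr rfl fun i _ => Finset.sum_congr rfl fun j _ => ?_
  have h1 : fderiv ℝ (fun y => bivCoeff F V x i j y (Ω y) + bivCoeff F V x i j y (Θ y)) x v =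
      fderiv ℝ (fun y => bivCoeff F V x i j y (Ω y)) x v +
        fderiv ℝ (fun y => bivCoeff F V x i j y (Θ y)) x v :=
    fderiv_fun_add_apply (hΩ i j) (hΘ i j) v
  rw [h1]
  module

/-- A bivector is half the sum of its coordinates times the exterior products of the vectors of
the local frame. -/
theorem sum_bivCoeff (x : Base m) (θ : ⋀[ℝ]^2 (V x)) :
    (1 / 2 : ℝ) • ∑ i, ∑ j, bivCoeff F V x i j x θ •
      wedge (locFrame F x i x) (locFrame F x j x) = θ := by
  let L : ⋀[ℝ]^2 (V x) →ₗ[ℝ] ⋀[ℝ]^2 (V x) := (1 / 2 : ℝ) • ∑ i, ∑ j,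
    (bivCoeff F V x i j x).smulRight (wedge (locFrame F x i x) (locFrame F x j x))
  have hL : L = LinearMap.id := by
    refine exteriorPower.linearMap_ext ?_
    ext w : 1
    have hw : exteriorPower.ιMulti ℝ 2 w = wedge (w 0) (w 1) := by
      rw [wedge]
      congr 1
      ext i
      fin_cases i <;> rfl
    have h1 : ∀ a : V x, ∑ i, locCoeff F V x i x a • locFrame F x i x = a := by
      intro a
      -- any section through `a` will do, since its expansion is evaluated at `x` only
      have := (eventually_eq_sum_locCoeff (F := F) (Function.update (fun y => (0 : V y)) x a)
        x).self_of_nhds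
      simpa using this.symm
    simp only [LinearMap.compAlternatingMap_apply, hw, LinearMap.id_apply, L,
      LinearMap.smul_apply, LinearMap.sum_apply, LinearMap.smulRight_apply, bivCoeff_wedge,
      sub_smul, Finset.sum_sub_distrib, sum_sum_smul_wedge, h1]
    rw [wedge_swap (w 0) (w 1)]
    module
  simpa [L] using congrArg (fun M => M θ) hL

theorem bivectorConn_smul {c : Base m → ℝ} {Ω : Π x, ⋀[ℝ]^2 (V x)} {x : Base m}
    (hc : DifferentiableAt ℝ c x) (hΩ : DiffBivectorAt F Ω x)
    (v : TangentSpace 𝓘(ℝ, Base m) x) :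
    bivectorConn cov (fun y => c y • Ω y) x v =
      c x • bivectorConn cov Ω x v + fderiv ℝ c x v • Ω x := by
  conv_rhs => rw [← sum_bivCoeff (F := F) x (Ω x)]
  simp only [bivectorConn_eq, smul_comm _ (1 / 2 : ℝ), ← smul_add, Finset.smul_sum,
    ← Finset.sum_add_distrib, map_smul]
  refine Finset.sum_congr rfl fun i _ => Finset.sum_congr rfl fun j _ => ?_
  have h1 : fderiv ℝ (fun y => c y • bivCoeff F V x i j y (Ω y)) x v =
      c x * fderiv ℝ (fun y => bivCoeff F V x i j y (Ω y)) x v +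
        fderiv ℝ c x v * bivCoeff F V x i j x (Ω x) :=
    fderiv_fun_mul_apply hc (hΩ i j) v
  rw [h1]
  module

/-- The Leibniz rule `∇̂(σ ∧ τ) = ∇σ ∧ τ + σ ∧ ∇τ`. -/
theorem bivectorConn_wedge {σ τ : Π x, V x} {x : Base m} (hσ : DiffSectionAt F σ x)
    (hτ : DiffSectionAt F τ x) (v : TangentSpace 𝓘(ℝ, Base m) x) :
    bivectorConn cov (fun y => wedge (σ y) (τ y)) x v =
      wedge (cov σ x v) (τ x) + wedge (σ x) (cov τ x v) := by
  have h1 : ∀ i j, fderiv ℝ (fun y => locCoeff F V x i y (σ y) * locCoeff F V x j y (τ y) -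
      locCoeff F V x i y (τ y) * locCoeff F V x j y (σ y)) x v =
      locCoeff F V x i x (σ x) * fderiv ℝ (fun y => locCoeff F V x j y (τ y)) x v +
        fderiv ℝ (fun y => locCoeff F V x i y (σ y)) x v * locCoeff F V x j x (τ x) -
      (locCoeff F V x i x (τ x) * fderiv ℝ (fun y => locCoeff F V x j y (σ y)) x v +
        fderiv ℝ (fun y => locCoeff F V x i y (τ y)) x v * locCoeff F V x j x (σ x)) := by
    intro i j
    have ha := differentiableAt_locCoeff hσ
    have hb := differentiableAt_locCoeff hτ
    refine (fderiv_fun_sub_apply ((ha i).mul (hb j)) ((hb i).mul (ha j)) v).trans ?_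
    exact congrArg₂ _ (fderiv_fun_mul_apply (ha i) (hb j) v) (fderiv_fun_mul_apply (hb i) (ha j) v)
  have hσ0 := (eventually_eq_sum_locCoeff (F := F) σ x).self_of_nhds
  have hτ0 := (eventually_eq_sum_locCoeff (F := F) τ x).self_of_nhds
  rw [bivectorConn_eq]
  simp only [bivCoeff_wedge, h1]
  rw [cov_eq_sum_locFrame cov hσ, cov_eq_sum_locFrame cov hτ]
  have key := half_sum_leibniz_wedge (fun i => locCoeff F V x i x (σ x))
    (fun i => locCoeff F V x i x (τ x))
    (fun i => fderiv ℝ (fun y => locCoeff F V x i y (σ y)) x v)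
    (fun i => fderiv ℝ (fun y => locCoeff F V x i y (τ y)) x v)
    (fun i => locFrame F x i x) (fun i => cov (locFrame F x i) x v)
  rwa [← hσ0, ← hτ0] at key

end BivectorConn

end VectorBundle

/-! ### The induced connection in a frame -/

section VectorBundle

variable {m : ℕ} {F : Type u} [NormedAddCommGroup F] [NormedSpace ℝ F]
  {V : Base m → Type v} [TopologicalSpace (TotalSpace F V)]
  [∀ x, AddCommGroup (V x)] [∀ x, Module ℝ (V x)] [∀ x, TopologicalSpace (V x)]
  [∀ x, IsTopologicalAddGroup (V x)] [∀ x, ContinuousSMul ℝ (V x)]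
  [FiberBundle F V] [VectorBundle ℝ F V]

/-- The component `A = ε ω⁴₁ + ω³₂` of the connection form, for which
`∇̂Ω_{ε,2} = A ⊗ Ω_{-ε,1} + B ⊗ Ω_{ε,3}`. -/
def formA (ε : ℝ) (om : Fin 4 → Fin 4 → Base m → Base m →L[ℝ] ℝ) (x : Base m) : Base m →L[ℝ] ℝ :=
  ε • om 3 0 x + om 2 1 x

/-- The component `B = ω⁴₃ + ε ω²₁` of the connection form, for which
`∇̂Ω_{ε,2} = A ⊗ Ω_{-ε,1} + B ⊗ Ω_{ε,3}`. -/
def formB (ε : ℝ) (om : Fin 4 → Fin 4 → Base m → Base m →L[ℝ] ℝ) (x : Base m) : Base m →L[ℝ] ℝ :=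
  om 3 2 x + ε • om 1 0 x

/-- The component `P = ω⁴₂ - ε ω³₁` of the connection form, for which
`∇̂Ω_{-ε,1} = A ⊗ Ω_{ε,2} + P ⊗ Ω_{ε,3}`. -/
def formP (ε : ℝ) (om : Fin 4 → Fin 4 → Base m → Base m →L[ℝ] ℝ) (x : Base m) : Base m →L[ℝ] ℝ :=
  om 3 1 x - ε • om 2 0 x

theorem formA_apply (ε : ℝ) (om : Fin 4 → Fin 4 → Base m → Base m →L[ℝ] ℝ) (x v : Base m) :
    formA ε om x v = ε * om 3 0 x v + om 2 1 x v := by simp [formA]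

theorem formB_apply (ε : ℝ) (om : Fin 4 → Fin 4 → Base m → Base m →L[ℝ] ℝ) (x v : Base m) :
    formB ε om x v = om 3 2 x v + ε * om 1 0 x v := by simp [formB]

theorem formP_apply (ε : ℝ) (om : Fin 4 → Fin 4 → Base m → Base m →L[ℝ] ℝ) (x v : Base m) :
    formP ε om x v = om 3 1 x v - ε * om 2 0 x v := by simp [formP]

variable {cov : CovariantDerivative 𝓘(ℝ, Base m) F V} {h : NeutralMetric F V}
  {o : BundleOrientation F V} {e : Fin 4 → Π x, V x}

/-- The skew-symmetry of the connection form, solved for the entries above the diagonal. -/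
theorem connForm_upper (hcov : IsHConnection h cov) (he : IsFrameOn h o e Set.univ)
    (x v : Base m) :
    (∀ i, connForm cov he.frame i i x v = 0) ∧
    connForm cov he.frame 0 1 x v = -connForm cov he.frame 1 0 x v ∧
    connForm cov he.frame 0 2 x v = connForm cov he.frame 2 0 x v ∧
    connForm cov he.frame 0 3 x v = connForm cov he.frame 3 0 x v ∧
    connForm cov he.frame 1 2 x v = connForm cov he.frame 2 1 x v ∧
    connForm cov he.frame 1 3 x v = connForm cov he.frame 3 1 x v ∧
    connForm cov he.frame 2 3 x v = -connForm cov he.frame 3 2 x v := by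
  have hsk := fun i j => connForm_skew hcov he i j x v
  have h01 := hsk 0 1
  have h02 := hsk 0 2
  have h03 := hsk 0 3
  have h12 := hsk 1 2
  have h13 := hsk 1 3
  have h23 := hsk 2 3
  simp only [sgn, Matrix.cons_val] at h01 h02 h03 h12 h13 h23
  refine ⟨fun i => ?_, by linarith, by linarith, by linarith, by linarith, by linarith,
    by linarith⟩
  have hii := hsk i i
  fin_cases i <;> simpa [sgn] using hii

/-- The covariant derivatives of a frame. -/
theorem cov_frame_expand (hcov : IsHConnection h cov) (he : IsFrameOn h o e Set.univ)
    (x v : Base m) :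
    cov (e 0) x v = connForm cov he.frame 1 0 x v • e 1 x + connForm cov he.frame 2 0 x v • e 2 x
        + connForm cov he.frame 3 0 x v • e 3 x ∧
    cov (e 1) x v = -connForm cov he.frame 1 0 x v • e 0 x + connForm cov he.frame 2 1 x v • e 2 x
        + connForm cov he.frame 3 1 x v • e 3 x ∧
    cov (e 2) x v = connForm cov he.frame 2 0 x v • e 0 x + connForm cov he.frame 2 1 x v • e 1 x
        + connForm cov he.frame 3 2 x v • e 3 x ∧
    cov (e 3) x v = connForm cov he.frame 3 0 x v • e 0 x + connForm cov he.frame 3 1 x v • e 1 x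
        - connForm cov he.frame 3 2 x v • e 2 x := by
  obtain ⟨d, h01, h02, h03, h12, h13, h23⟩ := connForm_upper hcov he x v
  simp only [cov_frame he, Fin.sum_univ_four, d, h01, h02, h03, h12, h13, h23]
  refine ⟨?_, ?_, ?_, ?_⟩ <;> module

section Conn

variable [FiniteDimensional ℝ F] [ContMDiffVectorBundle ∞ F V 𝓘(ℝ, Base m)]

theorem diffBivectorAt_wedge_frame (he : IsFrameOn h o e Set.univ) (i j : Fin 4) (x : Base m) :
    DiffBivectorAt F (fun y => wedge (e i y) (e j y)) x :=
  .wedge (he.diffSectionAt i x) (he.diffSectionAt j x)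

variable (cov) in
/-- The covariant derivative of a bivector field of the shape of `Ω_{δ,1}`, `Ω_{δ,2}`, `Ω_{δ,3}`. -/
theorem bivectorConn_pair (he : IsFrameOn h o e Set.univ) (r δ : ℝ) (i j k l : Fin 4)
    (x v : Base m) :
    bivectorConn cov (fun y => r • (wedge (e i y) (e j y) + δ • wedge (e k y) (e l y))) x v =
      r • (wedge (cov (e i) x v) (e j x) + wedge (e i x) (cov (e j) x v) +
        δ • (wedge (cov (e k) x v) (e l x) + wedge (e k x) (cov (e l) x v))) := by
  have h1 := diffBivectorAt_wedge_frame he i j x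
  have h2 := diffBivectorAt_wedge_frame he k l x
  have hc : ∀ c : ℝ, DifferentiableAt ℝ (fun _ : Base m => c) x := differentiableAt_const
  have h0 : ∀ c : ℝ, fderiv ℝ (fun _ : Base m => c) x v = 0 := by simp
  refine (bivectorConn_smul cov (hc r) (h1.add (h2.smul (hc δ))) v).trans ?_
  refine (congrArg₂ (· + ·) (congrArg _ ((bivectorConn_add cov h1 (h2.smul (hc δ)) v).trans
    (congrArg₂ (· + ·) (bivectorConn_wedge cov (he.diffSectionAt i x) (he.diffSectionAt j x) v)
    ((bivectorConn_smul cov (hc δ) h2 v).trans (congrArg₂ (· + ·) (congrArg _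
      (bivectorConn_wedge cov (he.diffSectionAt k x) (he.diffSectionAt l x) v))
      (congrArg (· • _) (h0 δ))))))) (congrArg (· • _) (h0 r))).trans ?_
  module

theorem diffBivectorAt_pair (he : IsFrameOn h o e Set.univ) (r δ : ℝ) (i j k l : Fin 4)
    (x : Base m) :
    DiffBivectorAt F (fun y => r • (wedge (e i y) (e j y) + δ • wedge (e k y) (e l y))) x :=
  .smul (differentiableAt_const r) ((diffBivectorAt_wedge_frame he i j x).add
    (.smul (differentiableAt_const δ) (diffBivectorAt_wedge_frame he k l x)))

theorem bivectorConn_Omega2 (hcov : IsHConnection h cov) (he : IsFrameOn h o e Set.univ) {ε : ℝ}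
    (hε : ε = 1 ∨ ε = -1) (x v : Base m) :
    bivectorConn cov (Omega2 ε e) x v =
      formA ε (connForm cov he.frame) x v • Omega1 (-ε) e x +
        formB ε (connForm cov he.frame) x v • Omega3 ε e x := by
  refine (bivectorConn_pair cov he _ _ _ _ _ _ x v).trans ?_
  obtain ⟨h0, h1, h2, h3⟩ := cov_frame_expand hcov he x v
  rw [h0, h1, h2, h3]
  simp only [Omega1, Omega3, formA_apply, formB_apply, wedge_add_left, wedge_add_right,
    wedge_smul_left, wedge_smul_right, wedge_self, sub_eq_add_neg, ← neg_smul,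
    wedge_swap (e 0 x) (e 3 x), wedge_swap (e 1 x) (e 2 x), wedge_swap (e 2 x) (e 3 x)]
  rcases hε with rfl | rfl <;> module

theorem bivectorConn_Omega1 (hcov : IsHConnection h cov) (he : IsFrameOn h o e Set.univ) {ε : ℝ}
    (hε : ε = 1 ∨ ε = -1) (x v : Base m) :
    bivectorConn cov (Omega1 (-ε) e) x v =
      formA ε (connForm cov he.frame) x v • Omega2 ε e x +
        formP ε (connForm cov he.frame) x v • Omega3 ε e x := by
  refine (bivectorConn_pair cov he _ _ _ _ _ _ x v).trans ?_
  obtain ⟨h0, h1, h2, h3⟩ := cov_frame_expand hcov he x v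
  rw [h0, h1, h2, h3]
  simp only [Omega2, Omega3, formA_apply, formP_apply, wedge_add_left, wedge_add_right,
    wedge_smul_left, wedge_smul_right, wedge_self, sub_eq_add_neg, ← neg_smul,
    wedge_swap (e 0 x) (e 2 x), wedge_swap (e 1 x) (e 2 x), wedge_swap (e 1 x) (e 3 x)]
  rcases hε with rfl | rfl <;> module

theorem bivectorConn_Omega3 (hcov : IsHConnection h cov) (he : IsFrameOn h o e Set.univ) {ε : ℝ}
    (hε : ε = 1 ∨ ε = -1) (x v : Base m) :
    bivectorConn cov (Omega3 ε e) x v =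
      formP ε (connForm cov he.frame) x v • Omega1 (-ε) e x -
        formB ε (connForm cov he.frame) x v • Omega2 ε e x := by
  refine (bivectorConn_pair cov he _ _ _ _ _ _ x v).trans ?_
  obtain ⟨h0, h1, h2, h3⟩ := cov_frame_expand hcov he x v
  rw [h0, h1, h2, h3]
  simp only [Omega1, Omega2, formP_apply, formB_apply, wedge_add_left, wedge_add_right,
    wedge_smul_left, wedge_smul_right, wedge_self, sub_eq_add_neg, ← neg_smul,
    wedge_swap (e 0 x) (e 1 x), wedge_swap (e 1 x) (e 3 x), wedge_swap (e 2 x) (e 3 x)]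
  rcases hε with rfl | rfl <;> module

theorem diffBivectorAt_Omega0 (he : IsFrameOn h o e Set.univ) (ε μ : ℝ) (x : Base m) :
    DiffBivectorAt F (Omega0 ε μ e) x :=
  (diffBivectorAt_pair he _ _ _ _ _ _ x).add
    (.smul (differentiableAt_const μ) (diffBivectorAt_pair he _ _ _ _ _ _ x))

/-- If `B = μ A`, then `Ω₀` is recurrent: `∇̂Ω₀ = μ P ⊗ Ω₀`. -/
theorem bivectorConn_Omega0 (hcov : IsHConnection h cov) (he : IsFrameOn h o e Set.univ)
    {ε μ : ℝ} (hε : ε = 1 ∨ ε = -1) (hμ : μ = 1 ∨ μ = -1) (x v : Base m)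
    (hB : formB ε (connForm cov he.frame) x v = μ * formA ε (connForm cov he.frame) x v) :
    bivectorConn cov (Omega0 ε μ e) x v =
      (μ * formP ε (connForm cov he.frame) x v) • Omega0 ε μ e x := by
  have h1 : DiffBivectorAt F (Omega1 (-ε) e) x := diffBivectorAt_pair he _ _ _ _ _ _ x
  have h3 : DiffBivectorAt F (Omega3 ε e) x := diffBivectorAt_pair he _ _ _ _ _ _ x
  have hc := differentiableAt_const (𝕜 := ℝ) (E := Base m) (x := x) μ
  refine (bivectorConn_add cov h1 (h3.smul hc) v).trans ?_
  refine (congrArg₂ (· + ·) (bivectorConn_Omega1 hcov he hε x v)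
    ((bivectorConn_smul cov hc h3 v).trans (congrArg₂ (· + ·)
      (congrArg _ (bivectorConn_Omega3 hcov he hε x v))
      (congrArg (· • _) (show fderiv ℝ (fun _ : Base m => μ) x v = 0 by simp))))).trans ?_
  rw [hB, Omega0]
  rcases hμ with rfl | rfl <;> module

end Conn

theorem bivectorMetric_Omega11 (he : IsFrameOn h o e Set.univ) {ε : ℝ} (hε : ε = 1 ∨ ε = -1)
    (x : Base m) : bivectorMetric h x (Omega1 (-ε) e x) (Omega1 (-ε) e x) = 1 := by
  have h2 : (√2)⁻¹ * (√2)⁻¹ = 1 / 2 := by rw [← mul_inv, Real.mul_self_sqrt] <;> norm_num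
  simp [Omega1, bivectorMetric_add_left, bivectorMetric_add_right, bivectorMetric_smul_left,
    bivectorMetric_smul_right, bivectorMetric_wedge, he.orthonormal x (Set.mem_univ x), sgn]
  rcases hε with rfl | rfl <;> linarith

theorem bivectorMetric_Omega33 (he : IsFrameOn h o e Set.univ) {ε : ℝ} (hε : ε = 1 ∨ ε = -1)
    (x : Base m) : bivectorMetric h x (Omega3 ε e x) (Omega3 ε e x) = -1 := by
  have h2 : (√2)⁻¹ * (√2)⁻¹ = 1 / 2 := by rw [← mul_inv, Real.mul_self_sqrt] <;> norm_num
  simp [Omega3, bivectorMetric_add_left, bivectorMetric_add_right, bivectorMetric_smul_left,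
    bivectorMetric_smul_right, bivectorMetric_wedge, he.orthonormal x (Set.mem_univ x), sgn]
  rcases hε with rfl | rfl <;> linarith

theorem bivectorMetric_Omega13 (he : IsFrameOn h o e Set.univ) (ε : ℝ) (x : Base m) :
    bivectorMetric h x (Omega1 (-ε) e x) (Omega3 ε e x) = 0 := by
  simp [Omega1, Omega3, bivectorMetric_add_left, bivectorMetric_add_right,
    bivectorMetric_smul_left,
    bivectorMetric_smul_right, bivectorMetric_wedge, he.orthonormal x (Set.mem_univ x)]

theorem bivectorMetric_Omega31 (he : IsFrameOn h o e Set.univ) (ε : ℝ) (x : Base m) :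
    bivectorMetric h x (Omega3 ε e x) (Omega1 (-ε) e x) = 0 := by
  simp [Omega1, Omega3, bivectorMetric_add_left, bivectorMetric_add_right,
    bivectorMetric_smul_left,
    bivectorMetric_smul_right, bivectorMetric_wedge, he.orthonormal x (Set.mem_univ x)]

/-- The restriction of `ĥ` to the plane spanned by `Ω_{-ε,1}` and `Ω_{ε,3}` is Lorentzian. -/
theorem bivectorMetric_self (he : IsFrameOn h o e Set.univ) {ε : ℝ} (hε : ε = 1 ∨ ε = -1)
    (x : Base m) (a b : ℝ) :
    bivectorMetric h x (a • Omega1 (-ε) e x + b • Omega3 ε e x)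
      (a • Omega1 (-ε) e x + b • Omega3 ε e x) = a ^ 2 - b ^ 2 := by
  simp only [bivectorMetric_add_left, bivectorMetric_add_right, bivectorMetric_smul_left,
    bivectorMetric_smul_right, bivectorMetric_Omega11 he hε, bivectorMetric_Omega33 he hε,
    bivectorMetric_Omega13 he, bivectorMetric_Omega31 he]
  ring

theorem Omega0_ne_zero (he : IsFrameOn h o e Set.univ) {ε : ℝ} (hε : ε = 1 ∨ ε = -1) (μ : ℝ)
    (x : Base m) : Omega0 ε μ e x ≠ 0 := by
  intro h0
  have h1 : bivectorMetric h x (Omega0 ε μ e x) (Omega1 (-ε) e x) = 1 := by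
    simp [Omega0, bivectorMetric_add_left, bivectorMetric_smul_left,
      bivectorMetric_Omega11 he hε, bivectorMetric_Omega31 he]
  rw [h0] at h1
  simp [bivectorMetric] at h1

end VectorBundle

/-! ### Closed forms and the potentials `f`, `g` -/

section Forms

variable {m : ℕ}

/-- The Poincaré lemma for smooth `1`-forms on `ℝᵐ`. -/
theorem exists_potential {α : Base m → Base m →L[ℝ] ℝ} (hα : ContDiff ℝ ∞ α)
    (hd : ∀ x v w, dOne α x v w = 0) :
    ∃ f : Base m → ℝ, ContDiff ℝ ∞ f ∧ ∀ x, fderiv ℝ f x = α x := by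
  have hdiff : Differentiable ℝ α := hα.differentiable (by simp)
  obtain ⟨f, hf⟩ := convex_univ.exists_forall_hasFDerivAt_of_fderiv_symmetric isOpen_univ
    hdiff.differentiableOn fun x _ v w => by
      have := hd x v w
      rw [dOne_apply (hdiff x)] at this
      linarith
  have hf' : ∀ x, HasFDerivAt f (α x) x := fun x => hf x (Set.mem_univ x)
  have hfd : fderiv ℝ f = α := funext fun x => (hf' x).fderiv
  exact ⟨f, contDiff_infty_iff_fderiv.2 ⟨fun x => (hf' x).differentiableAt, hfd ▸ hα⟩,
    fun x => (hf' x).fderiv⟩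

theorem dOne_smul {c : Base m → ℝ} {α : Base m → Base m →L[ℝ] ℝ} {x : Base m}
    (hc : DifferentiableAt ℝ c x) (hα : DifferentiableAt ℝ α x) (v w : Base m) :
    dOne (fun y => c y • α y) x v w = wedgeOne (fderiv ℝ c) α x v w + c x * dOne α x v w := by
  rw [dOne_apply (hc.fun_smul hα), dOne_apply hα, fderiv_fun_smul hc hα]
  simp [wedgeOne]
  ring

/-- If `dP = A ∧ B`, `dA = -P ∧ B` and `B = μ A`, then `P = -df` and `A = exp (μ f) dg`:
`P` is closed because `A ∧ B = 0`, and `exp (-μ f) A` is closed because `dA = μ df ∧ A`. -/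
theorem exists_potentials {A B P : Base m → Base m →L[ℝ] ℝ} {μ : ℝ}
    (hA : ContDiff ℝ ∞ A) (hP : ContDiff ℝ ∞ P) (hAB : ∀ x, B x = μ • A x)
    (hdP : ∀ x v w, dOne P x v w = wedgeOne A B x v w)
    (hdA : ∀ x v w, dOne A x v w = -wedgeOne P B x v w) :
    ∃ f g : Base m → ℝ, ContDiff ℝ ∞ f ∧ ContDiff ℝ ∞ g ∧
      (∀ x, P x = -fderiv ℝ f x) ∧ ∀ x, A x = Real.exp (μ * f x) • fderiv ℝ g x := by
  obtain ⟨f, hf, hfP⟩ := exists_potential (α := fun x => (-1 : ℝ) • P x)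
    (contDiff_const.fun_smul hP) fun x v w => by
      rw [dOne_smul (differentiableAt_const _) (hP.differentiable (by simp) x), hdP]
      simp [wedgeOne, hAB]
      ring
  have hfd : ∀ x, HasFDerivAt f ((-1 : ℝ) • P x) x := fun x =>
    hfP x ▸ (hf.differentiable (by simp) x).hasFDerivAt
  have hc : ContDiff ℝ ∞ fun x => Real.exp (-(μ * f x)) := (contDiff_const.mul hf).neg.exp
  have hcd : ∀ x, fderiv ℝ (fun x => Real.exp (-(μ * f x))) x =
      (Real.exp (-(μ * f x)) * μ) • P x := by
    intro x
    have h1 : HasFDerivAt (fun x => Real.exp (-(μ * f x)))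
        (Real.exp (-(μ * f x)) • -(μ • (-1 : ℝ) • P x)) x := ((hfd x).const_mul μ).neg.exp
    rw [h1.fderiv]
    module
  obtain ⟨g, hg, hgA⟩ := exists_potential (hc.fun_smul hA) fun x v w => by
      rw [dOne_smul (hc.differentiable (by simp) x) (hA.differentiable (by simp) x), hdA]
      simp only [wedgeOne, hcd, hAB, smul_apply, smul_eq_mul]
      ring
  refine ⟨f, g, hf, hg, fun x => by rw [hfP]; module, fun x => ?_⟩
  rw [hgA, smul_smul, ← Real.exp_add]
  simp

/-- If the product of two linear functionals vanishes, so does one of them. -/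
theorem eq_zero_or_eq_zero_of_mul {E : Type*} [AddCommGroup E] [Module ℝ E]
    [TopologicalSpace E] {p q : E →L[ℝ] ℝ}
    (hpq : ∀ v, p v * q v = 0) : p = 0 ∨ q = 0 := by
  by_contra! hne
  obtain ⟨⟨u, hu⟩, ⟨w, hw⟩⟩ := And.intro (DFunLike.ne_iff.1 hne.1) (DFunLike.ne_iff.1 hne.2)
  simp only [zero_apply] at hu hw
  have h1 : q u = 0 := (mul_eq_zero.1 (hpq u)).resolve_left hu
  have h2 : p w = 0 := (mul_eq_zero.1 (hpq w)).resolve_right hw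
  have h3 := hpq (u + w)
  rw [map_add, map_add, h1, h2, add_zero, zero_add] at h3
  exact (mul_ne_zero hu hw) h3

/-- If `A² = B²` and `A` vanishes nowhere, then `B = μ A` with a constant sign `μ`, because
`ℝᵐ` is connected. -/
theorem exists_sign {A B : Base m → Base m →L[ℝ] ℝ} (hA : Continuous A) (hB : Continuous B)
    (hA0 : ∀ x, A x ≠ 0) (hsq : ∀ x v, A x v ^ 2 - B x v ^ 2 = 0) :
    ∃ μ : ℝ, (μ = 1 ∨ μ = -1) ∧ ∀ x, B x = μ • A x := by
  have hor : ∀ x, B x = A x ∨ B x = -A x := by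
    intro x
    rcases eq_zero_or_eq_zero_of_mul (p := B x - A x) (q := B x + A x) fun v => by
      have := hsq x v
      simp only [sub_apply, add_apply]
      linarith with h | h
    · exact Or.inl (sub_eq_zero.1 h)
    · exact Or.inr (eq_neg_of_add_eq_zero_left h)
  have hcompl : {x | B x = A x}ᶜ = {x | B x = -A x} := by
    ext x
    refine ⟨fun hx => (hor x).resolve_left hx, fun hx hx' => hA0 x ?_⟩
    have h1 : B x = -A x := hx
    have h2 : B x = A x := hx'
    rw [h2] at h1
    ext v
    have h3 := congrArg (fun L => L v) h1
    simp only [neg_apply] at h3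
    simp only [zero_apply]
    linarith
  have hclopen : IsClopen {x | B x = A x} :=
    ⟨isClosed_eq hB hA, by
      rw [← isClosed_compl_iff, hcompl]
      exact isClosed_eq hB hA.neg⟩
  rcases isClopen_iff.1 hclopen with h | h
  · rw [h, Set.compl_empty] at hcompl
    refine ⟨-1, Or.inr rfl, fun x => ?_⟩
    have : x ∈ {x | B x = -A x} := hcompl ▸ Set.mem_univ x
    exact this.trans (neg_one_smul ℝ (A x)).symm
  · refine ⟨1, Or.inl rfl, fun x => ?_⟩
    have : x ∈ {x | B x = A x} := h ▸ Set.mem_univ x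
    exact this.trans (one_smul ℝ (A x)).symm

end Forms

section VectorBundle

variable {m : ℕ} {F : Type u} [NormedAddCommGroup F] [NormedSpace ℝ F]
  {V : Base m → Type v} [TopologicalSpace (TotalSpace F V)]
  [∀ x, AddCommGroup (V x)] [∀ x, Module ℝ (V x)] [∀ x, TopologicalSpace (V x)]
  [∀ x, IsTopologicalAddGroup (V x)] [∀ x, ContinuousSMul ℝ (V x)]
  [FiberBundle F V] [VectorBundle ℝ F V]

variable {cov : CovariantDerivative 𝓘(ℝ, Base m) F V} {h : NeutralMetric F V}
  {o : BundleOrientation F V} {e : Fin 4 → Π x, V x}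

/-! ### The structure equations -/

theorem contDiff_formA (hcov : IsHConnection h cov) (he : IsFrameOn h o e Set.univ) (ε : ℝ) :
    ContDiff ℝ ∞ (formA ε (connForm cov he.frame)) :=
  (contDiff_const.fun_smul (contDiff_connForm hcov he 3 0)).add (contDiff_connForm hcov he 2 1)

theorem contDiff_formB (hcov : IsHConnection h cov) (he : IsFrameOn h o e Set.univ) (ε : ℝ) :
    ContDiff ℝ ∞ (formB ε (connForm cov he.frame)) :=
  (contDiff_connForm hcov he 3 2).add (contDiff_const.fun_smul (contDiff_connForm hcov he 1 0))

theorem contDiff_formP (hcov : IsHConnection h cov) (he : IsFrameOn h o e Set.univ) (ε : ℝ) :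
    ContDiff ℝ ∞ (formP ε (connForm cov he.frame)) :=
  (contDiff_connForm hcov he 3 1).sub (contDiff_const.fun_smul (contDiff_connForm hcov he 2 0))

/-- The six independent structure equations of a flat `h`-connection. -/
theorem structure_equations (hcov : IsHConnection h cov) (hflat : IsFlat cov)
    (he : IsFrameOn h o e Set.univ) (x v w : Base m) :
    let om := connForm cov he.frame
    dOne (om 1 0) x v w =
      wedgeOne (om 2 0) (om 2 1) x v w - wedgeOne (om 3 1) (om 3 0) x v w ∧
    dOne (om 2 0) x v w =
      wedgeOne (om 1 0) (om 2 1) x v w + wedgeOne (om 3 2) (om 3 0) x v w ∧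
    dOne (om 2 1) x v w =
      wedgeOne (om 2 0) (om 1 0) x v w + wedgeOne (om 3 2) (om 3 1) x v w ∧
    dOne (om 3 0) x v w =
      -wedgeOne (om 3 1) (om 1 0) x v w - wedgeOne (om 3 2) (om 2 0) x v w ∧
    dOne (om 3 1) x v w =
      wedgeOne (om 3 0) (om 1 0) x v w - wedgeOne (om 3 2) (om 2 1) x v w ∧
    dOne (om 3 2) x v w =
      -wedgeOne (om 3 0) (om 2 0) x v w - wedgeOne (om 3 1) (om 2 1) x v w := by
  intro om
  obtain ⟨d, h01, h02, -, h12, h13, h23⟩ := connForm_upper hcov he x v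
  obtain ⟨d', k01, k02, -, k12, k13, k23⟩ := connForm_upper hcov he x w
  refine ⟨?_, ?_, ?_, ?_, ?_, ?_⟩ <;>
  · rw [dOne_connForm hcov hflat he]
    simp only [wedgeOne, Fin.sum_univ_four, d, d', h01, h02, h12, h13, h23, k01, k02,
      k12, k13, k23, om]
    ring

theorem dOne_formP (hcov : IsHConnection h cov) (hflat : IsFlat cov)
    (he : IsFrameOn h o e Set.univ) {ε : ℝ} (hε : ε = 1 ∨ ε = -1) (x v w : Base m) :
    dOne (formP ε (connForm cov he.frame)) x v w =
      wedgeOne (formA ε (connForm cov he.frame)) (formB ε (connForm cov he.frame)) x v w := by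
  have hd : ∀ i j, Differentiable ℝ (connForm cov he.frame i j) := fun i j =>
    (contDiff_connForm hcov he i j).differentiable (by simp)
  have h1 : dOne (formP ε (connForm cov he.frame)) x v w =
      dOne (connForm cov he.frame 3 1) x v w - ε * dOne (connForm cov he.frame 2 0) x v w := by
    rw [dOne_apply ((contDiff_formP hcov he ε).differentiable (by simp) x), dOne_apply (hd 3 1 x),
      dOne_apply (hd 2 0 x)]
    have : fderiv ℝ (formP ε (connForm cov he.frame)) x =
        fderiv ℝ (connForm cov he.frame 3 1) x - ε • fderiv ℝ (connForm cov he.frame 2 0) x :=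
      ((hd 3 1 x).hasFDerivAt.sub ((hd 2 0 x).hasFDerivAt.const_smul ε)).fderiv
    simp [this]
    ring
  obtain ⟨-, h20, -, -, h31, -⟩ := structure_equations hcov hflat he x v w
  rw [h1, h20, h31]
  simp only [wedgeOne, formA_apply, formB_apply]
  rcases hε with rfl | rfl <;> ring

theorem dOne_formA (hcov : IsHConnection h cov) (hflat : IsFlat cov)
    (he : IsFrameOn h o e Set.univ) {ε : ℝ} (hε : ε = 1 ∨ ε = -1) (x v w : Base m) :
    dOne (formA ε (connForm cov he.frame)) x v w =
      -wedgeOne (formP ε (connForm cov he.frame)) (formB ε (connForm cov he.frame)) x v w := by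
  have hd : ∀ i j, Differentiable ℝ (connForm cov he.frame i j) := fun i j =>
    (contDiff_connForm hcov he i j).differentiable (by simp)
  have h1 : dOne (formA ε (connForm cov he.frame)) x v w =
      ε * dOne (connForm cov he.frame 3 0) x v w + dOne (connForm cov he.frame 2 1) x v w := by
    rw [dOne_apply ((contDiff_formA hcov he ε).differentiable (by simp) x), dOne_apply (hd 3 0 x),
      dOne_apply (hd 2 1 x)]
    have : fderiv ℝ (formA ε (connForm cov he.frame)) x =
        ε • fderiv ℝ (connForm cov he.frame 3 0) x + fderiv ℝ (connForm cov he.frame 2 1) x :=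
      (((hd 3 0 x).hasFDerivAt.const_smul ε).add (hd 2 1 x).hasFDerivAt).fderiv
    simp [this]
    ring
  obtain ⟨-, -, h21, h30, -, -⟩ := structure_equations hcov hflat he x v w
  rw [h1, h30, h21]
  simp only [wedgeOne, formP_apply, formB_apply]
  rcases hε with rfl | rfl <;> ring

theorem sign_mul_self {ε : ℝ} (hε : ε = 1 ∨ ε = -1) : ε * ε = 1 := by
  rcases hε with rfl | rfl <;> norm_num

theorem ConnRelations.formA_eq {ε μ : ℝ} (hε : ε = 1 ∨ ε = -1) {f g : Base m → ℝ}
    {om : Fin 4 → Fin 4 → Base m → Base m →L[ℝ] ℝ} (H : ConnRelations ε μ f g om) (x : Base m) :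
    formA ε om x = Real.exp (μ * f x) • fderiv ℝ g x := by
  rw [formA, H.rel41]
  rcases hε with rfl | rfl <;> module

theorem ConnRelations.formB_eq {ε μ : ℝ} {f g : Base m → ℝ}
    {om : Fin 4 → Fin 4 → Base m → Base m →L[ℝ] ℝ} (H : ConnRelations ε μ f g om) (x : Base m) :
    formB ε om x = (μ * Real.exp (μ * f x)) • fderiv ℝ g x := by
  rw [formB, H.rel43]
  module

theorem ConnRelations.formP_eq {ε μ : ℝ} {f g : Base m → ℝ}
    {om : Fin 4 → Fin 4 → Base m → Base m →L[ℝ] ℝ} (H : ConnRelations ε μ f g om) (x : Base m) :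
    formP ε om x = -fderiv ℝ f x := by
  rw [formP, H.rel42]
  module

/-- The relations for the connection form follow from `A = exp (μ f) dg`, `B = μ A`, `P = -df`
and the structure equations. -/
theorem connRelations_of_forms (hcov : IsHConnection h cov) (hflat : IsFlat cov)
    (he : IsFrameOn h o e Set.univ) {ε μ : ℝ} (hε : ε = 1 ∨ ε = -1) (hμ : μ = 1 ∨ μ = -1)
    {f g : Base m → ℝ} (hf : ContDiff ℝ ∞ f) (hg : ContDiff ℝ ∞ g)
    (hg0 : ∀ x, fderiv ℝ g x ≠ 0)
    (hA : ∀ x, formA ε (connForm cov he.frame) x = Real.exp (μ * f x) • fderiv ℝ g x)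
    (hB : ∀ x, formB ε (connForm cov he.frame) x = μ • formA ε (connForm cov he.frame) x)
    (hP : ∀ x, formP ε (connForm cov he.frame) x = -fderiv ℝ f x) :
    ConnRelations ε μ f g (connForm cov he.frame) := by
  have r41 : ∀ x v, connForm cov he.frame 3 0 x v =
      ε * Real.exp (μ * f x) * fderiv ℝ g x v - ε * connForm cov he.frame 2 1 x v := by
    intro x v
    have h1 := congrArg (fun L => L v) (hA x)
    simp only [formA_apply, smul_apply, smul_eq_mul] at h1
    linear_combination ε * h1 - connForm cov he.frame 3 0 x v * sign_mul_self hε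
  have r42 : ∀ x v, connForm cov he.frame 3 1 x v =
      ε * connForm cov he.frame 2 0 x v - fderiv ℝ f x v := by
    intro x v
    have h1 := congrArg (fun L => L v) (hP x)
    simp only [formP_apply, neg_apply] at h1
    linear_combination h1
  have r43 : ∀ x v, connForm cov he.frame 3 2 x v =
      μ * Real.exp (μ * f x) * fderiv ℝ g x v - ε * connForm cov he.frame 1 0 x v := by
    intro x v
    have h1 := congrArg (fun L => L v) (hB x)
    rw [hA] at h1
    simp only [formB_apply, smul_apply, smul_eq_mul] at h1
    linear_combination h1
  refine ⟨hμ, hf, hg, hg0, fun x => ?_, fun x => ?_, fun x => ?_, fun x v w => ?_,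
    fun x v w => ?_, fun x v w => ?_⟩
  · ext v; simp [r41]
  · ext v; simp [r42]
  · ext v; simp [r43]
  · rw [(structure_equations hcov hflat he x v w).1]
    simp only [wedgeOne, r41, r42]
    rcases hε with rfl | rfl <;> ring
  · rw [(structure_equations hcov hflat he x v w).2.1]
    simp only [wedgeOne, r41, r43]
    rcases hε with rfl | rfl <;> ring
  · rw [(structure_equations hcov hflat he x v w).2.2.1]
    simp only [wedgeOne, r42, r43]
    rcases hε with rfl | rfl <;> ring

variable [FiniteDimensional ℝ F] [ContMDiffVectorBundle ∞ F V 𝓘(ℝ, Base m)]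

theorem ConnRelations.bivectorConn_Omega2 (hcov : IsHConnection h cov)
    (he : IsFrameOn h o e Set.univ) {ε μ : ℝ} (hε : ε = 1 ∨ ε = -1) {f g : Base m → ℝ}
    (H : ConnRelations ε μ f g (connForm cov he.frame)) (x v : Base m) :
    bivectorConn cov (Omega2 ε e) x v =
      (Real.exp (μ * f x) * fderiv ℝ g x v) • Omega0 ε μ e x := by
  rw [FlatNeutral.bivectorConn_Omega2 hcov he hε, H.formA_eq hε, H.formB_eq, Omega0]
  simp only [smul_apply, smul_eq_mul]
  module

/-- If `∇̂Ω_{ε,2}` is fully light-like, then `A` vanishes nowhere and `B = μ A` for a constant sign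
`μ`. -/
theorem FullyLightLike.forms (hcov : IsHConnection h cov) (he : IsFrameOn h o e Set.univ)
    {ε : ℝ} (hε : ε = 1 ∨ ε = -1) (H : FullyLightLike h cov (Omega2 ε e)) :
    (∀ x, formA ε (connForm cov he.frame) x ≠ 0) ∧ ∃ μ : ℝ, (μ = 1 ∨ μ = -1) ∧
      ∀ x, formB ε (connForm cov he.frame) x = μ • formA ε (connForm cov he.frame) x := by
  have hsq : ∀ x v, formA ε (connForm cov he.frame) x v ^ 2
      - formB ε (connForm cov he.frame) x v ^ 2 = 0 := by
    intro x v
    have h1 := (H x).1 v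
    rwa [bivectorConn_Omega2 hcov he hε, bivectorMetric_self he hε] at h1
  have hA0 : ∀ x, formA ε (connForm cov he.frame) x ≠ 0 := by
    intro x hx
    obtain ⟨v, hv⟩ := (H x).2
    refine hv ?_
    have h1 := hsq x v
    have h2 : formA ε (connForm cov he.frame) x v = 0 := by rw [hx]; rfl
    rw [h2] at h1
    have h3 : formB ε (connForm cov he.frame) x v = 0 := by
      rw [← sq_eq_zero_iff]
      linarith
    refine (bivectorConn_Omega2 hcov he hε x v).trans ?_
    rw [h2, h3]
    module
  exact ⟨hA0, exists_sign (contDiff_formA hcov he ε).continuous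
    (contDiff_formB hcov he ε).continuous hA0 hsq⟩

theorem fullyLightLike_iff (hcov : IsHConnection h cov) (hflat : IsFlat cov)
    (he : IsFrameOn h o e Set.univ) {ε : ℝ} (hε : ε = 1 ∨ ε = -1) :
    FullyLightLike h cov (Omega2 ε e) ↔
      ∃ (f g : Base m → ℝ) (μ : ℝ), ConnRelations ε μ f g (connForm cov he.frame) := by
  constructor
  · intro H
    obtain ⟨hA0, μ, hμ, hB⟩ := H.forms hcov he hε
    obtain ⟨f, g, hf, hg, hP, hA⟩ := exists_potentials (contDiff_formA hcov he ε)
      (contDiff_formP hcov he ε) hB (dOne_formP hcov hflat he hε) (dOne_formA hcov hflat he hε)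
    refine ⟨f, g, μ, connRelations_of_forms hcov hflat he hε hμ hf hg (fun x hx => hA0 x ?_)
      hA hB hP⟩
    rw [hA, hx, smul_zero]
  · rintro ⟨f, g, μ, H⟩ x
    have h1 := H.bivectorConn_Omega2 hcov he hε x
    refine ⟨fun v => ?_, ?_⟩
    · refine (congrArg (fun θ => bivectorMetric h x θ θ) (h1 v)).trans ?_
      beta_reduce
      rw [bivectorMetric_smul_left, bivectorMetric_smul_right, Omega0,
        ← one_smul ℝ (Omega1 (-ε) e x), bivectorMetric_self he hε]
      rcases H.sign with rfl | rfl <;> simp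
    · obtain ⟨v, hv⟩ := DFunLike.ne_iff.1 (H.dg_ne x)
      refine ⟨v, ?_⟩
      intro h2
      exact smul_ne_zero (mul_ne_zero (Real.exp_ne_zero _) hv) (Omega0_ne_zero he hε μ x)
        ((h1 v).symm.trans h2)

end VectorBundle

/-! ### Boosted frames -/

section VectorBundle

variable {m : ℕ} {F : Type u} [NormedAddCommGroup F] [NormedSpace ℝ F]
  {V : Base m → Type v} [TopologicalSpace (TotalSpace F V)]
  [∀ x, AddCommGroup (V x)] [∀ x, Module ℝ (V x)] [∀ x, TopologicalSpace (V x)]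
  [∀ x, IsTopologicalAddGroup (V x)] [∀ x, ContinuousSMul ℝ (V x)]
  [FiberBundle F V] [VectorBundle ℝ F V]

variable {cov : CovariantDerivative 𝓘(ℝ, Base m) F V} {h : NeutralMetric F V}
  {o : BundleOrientation F V} {e : Fin 4 → Π x, V x}

/-- The frame obtained from `e` by the hyperbolic rotation with angle `t` in the plane of
`e₁, e₃` and the one with angle `-ε t` in the plane of `e₂, e₄`. It has the same `Ω_{ε,2}`. -/
def boost (ε : ℝ) (t : Base m → ℝ) (e : Fin 4 → Π x, V x) (i : Fin 4) (x : Base m) : V x :=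
  ![Real.cosh (t x) • e 0 x + Real.sinh (t x) • e 2 x,
    Real.cosh (t x) • e 1 x + (-ε * Real.sinh (t x)) • e 3 x,
    Real.sinh (t x) • e 0 x + Real.cosh (t x) • e 2 x,
    (-ε * Real.sinh (t x)) • e 1 x + Real.cosh (t x) • e 3 x] i

theorem smoothSectionOn_boost (he : IsFrameOn h o e Set.univ) (ε : ℝ) {t : Base m → ℝ}
    (ht : ContDiff ℝ ∞ t) (i : Fin 4) : SmoothSectionOn F (boost ε t e i) Set.univ := by
  have hc : ContDiffOn ℝ ∞ (fun x => Real.cosh (t x)) Set.univ := ht.cosh.contDiffOn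
  have hs : ContDiffOn ℝ ∞ (fun x => Real.sinh (t x)) Set.univ := ht.sinh.contDiffOn
  have hs' : ContDiffOn ℝ ∞ (fun x => -ε * Real.sinh (t x)) Set.univ := contDiffOn_const.mul hs
  have hk := he.smoothSectionOn
  fin_cases i
  · exact ((hk 0).smul hc).add ((hk 2).smul hs)
  · exact ((hk 1).smul hc).add ((hk 3).smul hs')
  · exact ((hk 0).smul hs).add ((hk 2).smul hc)
  · exact ((hk 1).smul hs').add ((hk 3).smul hc)

theorem det_boost (he : IsFrameOn h o e Set.univ) {ε : ℝ} (hε : ε = 1 ∨ ε = -1)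
    (t : Base m → ℝ) (x : Base m) :
    (he.frame.toBasisAt (Set.mem_univ x)).det (fun i => boost ε t e i x) = 1 := by
  have hr : ∀ i j, (he.frame.toBasisAt (Set.mem_univ x)).repr (e j x) i = if i = j then 1 else 0 :=
    fun i j => by
      rw [← he.frame.toBasisAt_coe (Set.mem_univ x) j, Basis.repr_self, Finsupp.single_apply]
      simp [eq_comm]
  have h1 := Real.cosh_sq (t x)
  rw [Basis.det_apply, Matrix.det_succ_row_zero]
  simp [Fin.sum_univ_succ, Matrix.det_succ_row_zero, Basis.toMatrix_apply, boost, hr,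
    Fin.succAbove]
  -- the determinant is `(cosh² - sinh²)²`
  rcases hε with rfl | rfl <;>
    linear_combination (Real.cosh (t x) ^ 2 - Real.sinh (t x) ^ 2 + 1) * h1

theorem isFrameOn_boost (he : IsFrameOn h o e Set.univ) {ε : ℝ} (hε : ε = 1 ∨ ε = -1)
    {t : Base m → ℝ} (ht : ContDiff ℝ ∞ t) : IsFrameOn h o (boost ε t e) Set.univ := by
  have hb : ∀ x, LinearIndependent ℝ (fun i => boost ε t e i x) ∧
      Submodule.span ℝ (Set.range fun i => boost ε t e i x) = ⊤ := fun x =>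
    (Basis.is_basis_iff_det (he.frame.toBasisAt (Set.mem_univ x))).2
      (by rw [det_boost he hε]; exact isUnit_one)
  have hf : IsLocalFrameOn 𝓘(ℝ, Base m) F ∞ (boost ε t e) Set.univ :=
    ⟨fun {x} _ => (hb x).1, fun {x} _ => (hb x).2.ge, smoothSectionOn_boost he ε ht⟩
  refine ⟨hf, fun x hx i j => ?_, fun x hx => ?_⟩
  · have h1 := Real.cosh_sq (t x)
    have h2 := he.orthonormal x hx
    fin_cases i <;> fin_cases j <;> simp [boost, h2, sgn] <;>
      rcases hε with rfl | rfl <;>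
      first | ring1 | linear_combination h1 | linear_combination -h1
  · rw [← he.oriented x hx]
    refine (Basis.orientation_eq_iff_det_pos _ _).2 ?_ |>.symm
    have : (fun i => boost ε t e i x) = hf.toBasisAt hx := by
      ext i
      simp
    rw [← this, det_boost he hε]
    exact one_pos

theorem Omega2_boost {ε : ℝ} (hε : ε = 1 ∨ ε = -1) (t : Base m → ℝ) :
    Omega2 ε (boost ε t e) = Omega2 ε e := by
  funext x
  have h1 : Omega2 ε (boost ε t e) x =
      (Real.cosh (t x) ^ 2 - Real.sinh (t x) ^ 2) • Omega2 ε e x := by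
    simp only [Omega2, boost, Matrix.cons_val, wedge_add_left, wedge_add_right, wedge_smul_left,
      wedge_smul_right, wedge_self, wedge_swap (e 0 x) (e 2 x), wedge_swap (e 1 x) (e 3 x)]
    rcases hε with rfl | rfl <;> module
  rw [h1, Real.cosh_sq, add_sub_cancel_left, one_smul]

/-- A boost only rescales `Ω₀`: the null vectors `e₁ - εμ e₃` and `e₂ + μ e₄`, whose exterior
product is `√2 Ω₀`, are eigenvectors of it. -/
theorem Omega0_boost {ε μ : ℝ} (hε : ε = 1 ∨ ε = -1) (hμ : μ = 1 ∨ μ = -1) (t : Base m → ℝ)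
    (x : Base m) :
    Omega0 ε μ (boost ε t e) x = Real.exp (-(ε * μ * (2 * t x))) • Omega0 ε μ e x := by
  have h1 : Real.exp (-(ε * μ * (2 * t x))) =
      (Real.cosh (t x) - ε * μ * Real.sinh (t x)) ^ 2 := by
    have h2 : Real.exp (-(ε * μ * t x)) = Real.cosh (t x) - ε * μ * Real.sinh (t x) := by
      rcases hε with rfl | rfl <;> rcases hμ with rfl | rfl <;>
        simp [← Real.cosh_add_sinh]
    rw [← h2, sq, ← Real.exp_add]
    ring_nf
  rw [h1]
  simp only [Omega0, Omega1, Omega3, boost, Matrix.cons_val, wedge_add_left, wedge_add_right,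
    wedge_smul_left, wedge_smul_right, wedge_swap (e 0 x) (e 1 x), wedge_swap (e 0 x) (e 3 x),
    wedge_swap (e 1 x) (e 2 x), wedge_swap (e 2 x) (e 3 x)]
  rcases hε with rfl | rfl <;> rcases hμ with rfl | rfl <;> module

section Conn

variable [FiniteDimensional ℝ F] [ContMDiffVectorBundle ∞ F V 𝓘(ℝ, Base m)]

/-- Since `∇̂Ω₀ = -μ df ⊗ Ω₀`, the multiple `exp (μ f) Ω₀` is horizontal; it is the field `Ω'₀` of
the frame boosted by the angle `-ε f / 2`. -/
theorem ConnRelations.exists_horizontal_frame (hcov : IsHConnection h cov)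
    (he : IsFrameOn h o e Set.univ) {ε μ : ℝ} (hε : ε = 1 ∨ ε = -1) {f g : Base m → ℝ}
    (H : ConnRelations ε μ f g (connForm cov he.frame)) :
    ∃ (e' : Fin 4 → Π x, V x) (α' : Base m → Base m →L[ℝ] ℝ),
      IsFrameOn h o e' Set.univ ∧ Omega2 ε e' = Omega2 ε e ∧
      ContDiff ℝ ∞ α' ∧ (∀ x, α' x ≠ 0) ∧
      (∀ x v, bivectorConn cov (Omega2 ε e) x v = α' x v • Omega0 ε μ e' x) ∧
      ∀ x v, bivectorConn cov (Omega0 ε μ e') x v = 0 := by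
  have hO : Omega0 ε μ (boost ε (fun x => -(ε * f x / 2)) e) =
      fun x => Real.exp (μ * f x) • Omega0 ε μ e x := by
    funext x
    rw [Omega0_boost hε H.sign]
    congr 2
    linear_combination μ * f x * sign_mul_self hε
  refine ⟨boost ε (fun x => -(ε * f x / 2)) e, fderiv ℝ g,
    isFrameOn_boost he hε ((contDiff_const.mul H.smooth_f).div_const 2).neg,
    Omega2_boost hε _, (contDiff_infty_iff_fderiv.1 H.smooth_g).2, H.dg_ne, fun x v => ?_,
    fun x v => ?_⟩
  · rw [hO]
    refine (H.bivectorConn_Omega2 hcov he hε x v).trans ?_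
    rw [smul_smul, mul_comm]
  · have hfd := (H.smooth_f.differentiable (by simp) x).hasFDerivAt
    have h1 : HasFDerivAt (fun x => Real.exp (μ * f x))
        (Real.exp (μ * f x) • μ • fderiv ℝ f x) x := (hfd.const_mul μ).exp
    have h2 : fderiv ℝ (fun x => Real.exp (μ * f x)) x v =
        Real.exp (μ * f x) * (μ * fderiv ℝ f x v) :=
      congrArg (fun L => L v) h1.fderiv
    have hB : formB ε (connForm cov he.frame) x v = μ * formA ε (connForm cov he.frame) x v := by
      rw [H.formA_eq hε, H.formB_eq, mul_smul]
      rfl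
    have hP : formP ε (connForm cov he.frame) x v = -fderiv ℝ f x v := by
      rw [H.formP_eq]
      rfl
    rw [hO, bivectorConn_smul cov h1.differentiableAt (diffBivectorAt_Omega0 he ε μ x), h2]
    refine (congrArg (fun θ => Real.exp (μ * f x) • θ + _)
      (bivectorConn_Omega0 hcov he hε H.sign x v hB)).trans ?_
    beta_reduce
    rw [hP]
    module

end Conn

end VectorBundle

/-! ### The paracomplex structure of a frame -/

section VectorBundle

variable {m : ℕ} {F : Type u} [NormedAddCommGroup F] [NormedSpace ℝ F]
  {V : Base m → Type v} [TopologicalSpace (TotalSpace F V)]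
  [∀ x, AddCommGroup (V x)] [∀ x, Module ℝ (V x)] [∀ x, TopologicalSpace (V x)]
  [∀ x, IsTopologicalAddGroup (V x)] [∀ x, ContinuousSMul ℝ (V x)]
  [FiberBundle F V] [VectorBundle ℝ F V]

variable {cov : CovariantDerivative 𝓘(ℝ, Base m) F V} {h : NeutralMetric F V}
  {o : BundleOrientation F V} {e : Fin 4 → Π x, V x}

variable (h) in
/-- The endomorphism field with `Je₁ = e₃`, `Je₂ = -ε e₄`, `Je₃ = e₁`, `Je₄ = -ε e₂`, in the form
`Ja = h(e₁, a) e₃ - h(e₃, a) e₁ + ε (h(e₄, a) e₂ - h(e₂, a) e₄)`. -/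
def paraJ (ε : ℝ) (e : Fin 4 → Π x, V x) (x : Base m) : V x →ₗ[ℝ] V x :=
  (h.inner x (e 0 x)).toLinearMap.smulRight (e 2 x)
    - (h.inner x (e 2 x)).toLinearMap.smulRight (e 0 x)
    + ε • ((h.inner x (e 3 x)).toLinearMap.smulRight (e 1 x)
      - (h.inner x (e 1 x)).toLinearMap.smulRight (e 3 x))

theorem paraJ_apply (ε : ℝ) (x : Base m) (a : V x) :
    paraJ h ε e x a = h.inner x (e 0 x) a • e 2 x - h.inner x (e 2 x) a • e 0 x
      + ε • (h.inner x (e 3 x) a • e 1 x - h.inner x (e 1 x) a • e 3 x) := by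
  simp [paraJ]

theorem paraJ_frame (he : IsFrameOn h o e Set.univ) (ε : ℝ) (x : Base m) :
    paraJ h ε e x (e 0 x) = e 2 x ∧ paraJ h ε e x (e 1 x) = -ε • e 3 x ∧
      paraJ h ε e x (e 2 x) = e 0 x ∧ paraJ h ε e x (e 3 x) = -ε • e 1 x := by
  refine ⟨?_, ?_, ?_, ?_⟩ <;> simp [paraJ_apply, he.orthonormal x (Set.mem_univ x), sgn]

theorem corresponds_iff (he : IsFrameOn h o e Set.univ) (ε : ℝ) {J : Π x, V x →ₗ[ℝ] V x} :
    Corresponds h J (Omega2 ε e) ↔ J = paraJ h ε e := by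
  have key : ∀ x a b, √2 * bivectorMetric h x (Omega2 ε e x) (wedge a b) =
      h.inner x (paraJ h ε e x a) b := by
    intro x a b
    have h2 : √2 * (1 / √2) = 1 := by
      rw [mul_one_div_cancel]
      simp
    rw [Omega2, bivectorMetric_smul_left, ← mul_assoc, h2, paraJ_apply, bivectorMetric_add_left,
      bivectorMetric_smul_left, bivectorMetric_wedge, bivectorMetric_wedge]
    simp
    ring
  constructor
  · intro H
    funext x
    ext a
    refine he.ext_inner (Set.mem_univ x) fun i => ?_
    rw [H x a, key]
  · rintro rfl x a b
    exact (key x a b).symm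

theorem paraJ_paraJ (he : IsFrameOn h o e Set.univ) {ε : ℝ} (hε : ε = 1 ∨ ε = -1) (x : Base m)
    (a : V x) : paraJ h ε e x (paraJ h ε e x a) = a := by
  obtain ⟨h0, h1, h2, h3⟩ := paraJ_frame he ε x
  conv_lhs => rw [he.eq_sum_coeff (Set.mem_univ x) a]
  conv_rhs => rw [he.eq_sum_coeff (Set.mem_univ x) a]
  simp only [Fin.sum_univ_four, map_add, map_smul, h0, h1, h2, h3]
  rcases hε with rfl | rfl <;> module

theorem inner_paraJ (ε : ℝ) (x : Base m) (a b : V x) :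
    h.inner x (paraJ h ε e x a) b = -h.inner x a (paraJ h ε e x b) := by
  have hs := fun i => h.symm x a (e i x)
  simp only [paraJ_apply, map_add, map_sub, map_smul, add_apply, sub_apply, smul_apply,
    smul_eq_mul, hs]
  ring

/-- The eigenspace of `J` for `η = ±1` is spanned by `e₁ + η e₃` and `e₂ - ηε e₄`. -/
theorem finrank_eigenspace_paraJ (he : IsFrameOn h o e Set.univ) {ε η : ℝ}
    (hε : ε = 1 ∨ ε = -1) (hη : η = 1 ∨ η = -1) (x : Base m) :
    finrank ℝ (Module.End.eigenspace (paraJ h ε e x) η) = 2 := by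
  obtain ⟨h0, h1, h2, h3⟩ := paraJ_frame he ε x
  set b : Fin 2 → V x := ![e 0 x + η • e 2 x, e 1 x - (η * ε) • e 3 x] with hb
  have hli : LinearIndependent ℝ b := by
    rw [LinearIndependent.pair_iff]
    intro s t hst
    have hc := he.coeff_frame (Set.mem_univ x)
    have k0 := congrArg (he.frame.coeff 0 x) hst
    have k1 := congrArg (he.frame.coeff 1 x) hst
    simp [hc] at k0 k1
    exact ⟨k0, k1⟩
  have hspan : Module.End.eigenspace (paraJ h ε e x) η = Submodule.span ℝ (Set.range b) := by
    apply le_antisymm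
    · intro a ha
      rw [Module.End.mem_eigenspace_iff] at ha
      -- the projection `(1 + η J) / 2` onto the eigenspace fixes `a`
      have h4 : a = (1 / 2 : ℝ) • (a + η • paraJ h ε e x a) := by
        rw [ha]
        rcases hη with rfl | rfl <;> module
      have hb0 : b 0 ∈ Submodule.span ℝ (Set.range b) := Submodule.subset_span ⟨0, rfl⟩
      have hb1 : b 1 ∈ Submodule.span ℝ (Set.range b) := Submodule.subset_span ⟨1, rfl⟩
      have h5 : a = (1 / 2 * (he.frame.coeff 0 x a + η * he.frame.coeff 2 x a)) • b 0 +
          (1 / 2 * (he.frame.coeff 1 x a - η * ε * he.frame.coeff 3 x a)) • b 1 := by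
        conv_lhs => rw [h4]
        conv_lhs => rw [he.eq_sum_coeff (Set.mem_univ x) a]
        simp only [Fin.sum_univ_four, map_add, map_smul, h0, h1, h2, h3, hb, Matrix.cons_val]
        rcases hη with rfl | rfl <;> rcases hε with rfl | rfl <;> module
      rw [h5]
      exact Submodule.add_mem _ (Submodule.smul_mem _ _ hb0) (Submodule.smul_mem _ _ hb1)
    · rw [Submodule.span_le]
      rintro _ ⟨i, rfl⟩
      rw [SetLike.mem_coe, Module.End.mem_eigenspace_iff]
      fin_cases i
      · simp only [hb, Fin.zero_eta, Matrix.cons_val, map_add, map_smul, h0, h2]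
        rcases hη with rfl | rfl <;> module
      · simp only [hb, Fin.mk_one, Matrix.cons_val, map_sub, map_smul, h1, h3]
        rcases hη with rfl | rfl <;> rcases hε with rfl | rfl <;> module
  rw [hspan, finrank_span_eq_card hli, Fintype.card_fin]

theorem isParacomplex_paraJ (he : IsFrameOn h o e Set.univ) {ε : ℝ} (hε : ε = 1 ∨ ε = -1) :
    IsParacomplex h o ε (paraJ h ε e) where
  sq := paraJ_paraJ he hε
  eigen_pos := finrank_eigenspace_paraJ he hε (Or.inl rfl)
  eigen_neg := finrank_eigenspace_paraJ he hε (Or.inr rfl)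
  reversing x a b := by rw [inner_paraJ, paraJ_paraJ he hε]
  admissible x := ⟨Set.univ, e, isOpen_univ, Set.mem_univ x, he, fun y _ => paraJ_frame he ε y⟩

/-! ### The distribution spanned by the values of `∇J` -/

/-- The null vector fields `e₁ - εμ e₃` and `e₂ + μ e₄`, which span a light-like plane field. Their
exterior product is `√2 Ω₀`. -/
def nullFrame (ε μ : ℝ) (e : Fin 4 → Π x, V x) (i : Fin 2) (x : Base m) : V x :=
  ![e 0 x - (ε * μ) • e 2 x, e 1 x + μ • e 3 x] i

theorem smoothSectionOn_nullFrame (he : IsFrameOn h o e Set.univ) (ε μ : ℝ) (i : Fin 2) :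
    SmoothSectionOn F (nullFrame ε μ e i) Set.univ := by
  have hk := he.smoothSectionOn
  have h2 : SmoothSectionOn F (fun x => e 0 x - (ε * μ) • e 2 x) Set.univ := by
    simp only [sub_eq_add_neg, ← neg_smul]
    exact (hk 0).add ((hk 2).smul contDiffOn_const)
  fin_cases i
  · exact h2
  · exact (hk 1).add ((hk 3).smul contDiffOn_const)

theorem linearIndependent_nullFrame (he : IsFrameOn h o e Set.univ) (ε μ : ℝ) (x : Base m) :
    LinearIndependent ℝ fun i => nullFrame ε μ e i x := by
  change LinearIndependent ℝ ![e 0 x - (ε * μ) • e 2 x, e 1 x + μ • e 3 x]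
  rw [LinearIndependent.pair_iff]
  intro s t hst
  have hc := he.coeff_frame (Set.mem_univ x)
  have k0 := congrArg (he.frame.coeff 0 x) hst
  have k1 := congrArg (he.frame.coeff 1 x) hst
  simp [hc] at k0 k1
  exact ⟨k0, k1⟩

theorem range_nullFrame (ε μ : ℝ) (x : Base m) :
    Set.range (fun i => nullFrame ε μ e i x) = {nullFrame ε μ e 0 x, nullFrame ε μ e 1 x} := by
  ext w
  simp [eq_comm]

theorem inner_nullFrame (he : IsFrameOn h o e Set.univ) {ε μ : ℝ} (hε : ε = 1 ∨ ε = -1)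
    (hμ : μ = 1 ∨ μ = -1) (x : Base m) (i j : Fin 2) :
    h.inner x (nullFrame ε μ e i x) (nullFrame ε μ e j x) = 0 := by
  fin_cases i <;> fin_cases j <;>
    simp [nullFrame, he.orthonormal x (Set.mem_univ x), sgn] <;>
    rcases hε with rfl | rfl <;> rcases hμ with rfl | rfl <;> norm_num

/-- `∇J` is tensorial. -/
theorem cov_paraJ_sub (he : IsFrameOn h o e Set.univ) (ε : ℝ) {σ : Π x, V x} {x : Base m}
    (hσ : DiffSectionAt F σ x) (v : TangentSpace 𝓘(ℝ, Base m) x) :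
    cov (fun y => paraJ h ε e y (σ y)) x v - paraJ h ε e x (cov σ x v) =
      ∑ i, he.frame.coeff i x (σ x) •
        (cov (fun y => paraJ h ε e y (e i y)) x v - paraJ h ε e x (cov (e i) x v)) := by
  have hd : ∀ i, DiffSectionAt F (fun y => paraJ h ε e y (e i y)) x := by
    have hk := fun i => he.diffSectionAt i x
    have hs := fun i => (hk i).smul (differentiableAt_const (-ε))
    intro i
    fin_cases i
    · exact (hk 2).congr_of_eventuallyEq (.of_forall fun y => by simp [(paraJ_frame he ε y).1])
    · exact (hs 3).congr_of_eventuallyEq (.of_forall fun y => by simp [(paraJ_frame he ε y).2.1])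
    · exact (hk 0).congr_of_eventuallyEq
        (.of_forall fun y => by simp [(paraJ_frame he ε y).2.2.1])
    · exact (hs 1).congr_of_eventuallyEq
        (.of_forall fun y => by simp [(paraJ_frame he ε y).2.2.2])
  have h1 : (fun y => paraJ h ε e y (σ y)) =
      fun y => ∑ i, he.frame.coeff i y (σ y) • paraJ h ε e y (e i y) := by
    funext y
    conv_lhs => rw [he.eq_sum_coeff (Set.mem_univ y) (σ y)]
    simp only [map_sum, map_smul]
  have hc := he.differentiableAt_coeff hσ
  rw [h1, cov_sum cov fun i => (hd i).smul (hc i), cov_eq_sum he hσ]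
  simp only [cov_smul cov (hc _) (hd _), map_sum, map_add, map_smul, ← Finset.sum_sub_distrib]
  refine Finset.sum_congr rfl fun i _ => ?_
  module

/-- The values of `∇J` on the frame, when `∇̂Ω_{ε,2} = A ⊗ Ω₀`. -/
theorem cov_paraJ_frame (hcov : IsHConnection h cov) (he : IsFrameOn h o e Set.univ)
    {ε μ : ℝ} (hε : ε = 1 ∨ ε = -1) (hμ : μ = 1 ∨ μ = -1) (x v : Base m)
    (hB : formB ε (connForm cov he.frame) x v = μ * formA ε (connForm cov he.frame) x v)
    (i : Fin 4) :
    cov (fun y => paraJ h ε e y (e i y)) x v - paraJ h ε e x (cov (e i) x v) =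
      formA ε (connForm cov he.frame) x v •
        ![nullFrame ε μ e 1 x, -nullFrame ε μ e 0 x, (ε * μ) • nullFrame ε μ e 1 x,
          μ • nullFrame ε μ e 0 x] i := by
  obtain ⟨h0, h1, h2, h3⟩ := cov_frame_expand hcov he x v
  obtain ⟨k0, k1, k2, k3⟩ := paraJ_frame he ε x
  have hJ : ∀ i, cov (fun y => paraJ h ε e y (e i y)) x v =
      ![cov (e 2) x v, -ε • cov (e 3) x v, cov (e 0) x v, -ε • cov (e 1) x v] i := by
    intro i
    fin_cases i
    · exact congrArg (fun σ => cov σ x v) (funext fun y => (paraJ_frame he ε y).1)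
    · exact (congrArg (fun σ => cov σ x v) (funext fun y => (paraJ_frame he ε y).2.1)).trans
        (cov_const_smul cov (-ε) (he.diffSectionAt 3 x) v)
    · exact congrArg (fun σ => cov σ x v) (funext fun y => (paraJ_frame he ε y).2.2.1)
    · exact (congrArg (fun σ => cov σ x v) (funext fun y => (paraJ_frame he ε y).2.2.2)).trans
        (cov_const_smul cov (-ε) (he.diffSectionAt 1 x) v)
  rw [hJ]
  have h43 : connForm cov he.frame 3 2 x v = μ * (ε * connForm cov he.frame 3 0 x v +
      connForm cov he.frame 2 1 x v) - ε * connForm cov he.frame 1 0 x v := by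
    rw [formA_apply, formB_apply] at hB
    linear_combination hB
  fin_cases i <;>
    simp only [Fin.zero_eta, Fin.mk_one, Fin.reduceFinMk, Matrix.cons_val, h0, h1, h2, h3,
      map_add, map_sub, map_smul, k0, k1, k2, k3, nullFrame, formA_apply, h43] <;>
    rcases hε with rfl | rfl <;> rcases hμ with rfl | rfl <;> module

/-- The values of `∇J` span the plane of the null frame, because `A` does not vanish. -/
theorem distOf_paraJ (hcov : IsHConnection h cov) (he : IsFrameOn h o e Set.univ)
    {ε μ : ℝ} (hε : ε = 1 ∨ ε = -1) (hμ : μ = 1 ∨ μ = -1)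
    (hA : ∀ x, formA ε (connForm cov he.frame) x ≠ 0)
    (hB : ∀ x, formB ε (connForm cov he.frame) x = μ • formA ε (connForm cov he.frame) x)
    (x : Base m) :
    distOf cov (paraJ h ε e) x = Submodule.span ℝ (Set.range fun i => nullFrame ε μ e i x) := by
  have hB' : ∀ v, formB ε (connForm cov he.frame) x v =
      μ * formA ε (connForm cov he.frame) x v := fun v => by rw [hB]; rfl
  have key := fun v i => cov_paraJ_frame hcov he hε hμ x v (hB' v) i
  have hn : ∀ i, nullFrame ε μ e i x ∈
      Submodule.span ℝ (Set.range fun i => nullFrame ε μ e i x) := fun i =>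
    Submodule.subset_span ⟨i, rfl⟩
  apply le_antisymm
  · refine Submodule.span_le.2 ?_
    rintro w ⟨σ, hσ, v, rfl⟩
    rw [SetLike.mem_coe, cov_paraJ_sub he ε (hσ.diffSectionAt Filter.univ_mem)]
    refine Submodule.sum_mem _ fun i _ => Submodule.smul_mem _ _ ?_
    refine (key v i) ▸ Submodule.smul_mem _ _ ?_
    fin_cases i
    · exact hn 1
    · exact Submodule.neg_mem _ (hn 0)
    · exact Submodule.smul_mem _ _ (hn 1)
    · exact Submodule.smul_mem _ _ (hn 0)
  · obtain ⟨v, hv⟩ := DFunLike.ne_iff.1 (hA x)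
    have hmem : ∀ i, formA ε (connForm cov he.frame) x v •
        ![nullFrame ε μ e 1 x, -nullFrame ε μ e 0 x, (ε * μ) • nullFrame ε μ e 1 x,
          μ • nullFrame ε μ e 0 x] i ∈ distOf cov (paraJ h ε e) x := fun i =>
      Submodule.subset_span ⟨e i, he.smoothSectionOn i, v, (key v i).symm⟩
    refine Submodule.span_le.2 ?_
    rintro w ⟨i, rfl⟩
    fin_cases i
    · exact (Submodule.neg_mem_iff _).1 ((Submodule.smul_mem_iff _ hv).1 (hmem 1))
    · exact (Submodule.smul_mem_iff _ hv).1 (hmem 0)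

/-- The derivatives of the null frame stay in its plane, which is why the plane field is
parallel. -/
theorem cov_nullFrame_mem (hcov : IsHConnection h cov) (he : IsFrameOn h o e Set.univ)
    {ε μ : ℝ} (hε : ε = 1 ∨ ε = -1) (hμ : μ = 1 ∨ μ = -1) (x v : Base m)
    (hB : formB ε (connForm cov he.frame) x v = μ * formA ε (connForm cov he.frame) x v)
    (i : Fin 2) :
    cov (nullFrame ε μ e i) x v ∈
      Submodule.span ℝ (Set.range fun i => nullFrame ε μ e i x) := by
  obtain ⟨h0, h1, h2, h3⟩ := cov_frame_expand hcov he x v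
  have h43 : connForm cov he.frame 3 2 x v = μ * (ε * connForm cov he.frame 3 0 x v +
      connForm cov he.frame 2 1 x v) - ε * connForm cov he.frame 1 0 x v := by
    rw [formA_apply, formB_apply] at hB
    linear_combination hB
  have hk := fun i => he.diffSectionAt i x
  have hs : ∀ c i, DiffSectionAt F (fun y => c • e i y) x := fun c i =>
    (hk i).smul (differentiableAt_const c)
  have hcv : ∀ c i j, cov (fun y => e i y + c • e j y) x v = cov (e i) x v + c • cov (e j) x v :=
    fun c i j => (cov_add cov (hk i) (hs c j) v).trans
      (congrArg _ (cov_const_smul cov c (hk j) v))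
  rw [range_nullFrame, Submodule.mem_span_pair]
  fin_cases i
  · have hn : nullFrame ε μ e 0 = fun y => e 0 y + (-(ε * μ)) • e 2 y := by
      funext y
      simp [nullFrame, sub_eq_add_neg]
    refine ⟨-(ε * μ) * connForm cov he.frame 2 0 x v, connForm cov he.frame 1 0 x v -
      ε * μ * connForm cov he.frame 2 1 x v, ?_⟩
    simp only [Fin.zero_eta]
    conv_rhs => rw [hn, hcv, h0, h2, h43]
    simp only [nullFrame, Matrix.cons_val]
    rcases hε with rfl | rfl <;> rcases hμ with rfl | rfl <;> module
  · have hn : nullFrame ε μ e 1 = fun y => e 1 y + μ • e 3 y := rfl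
    refine ⟨-connForm cov he.frame 1 0 x v + μ * connForm cov he.frame 3 0 x v,
      μ * connForm cov he.frame 3 1 x v, ?_⟩
    simp only [Fin.mk_one]
    conv_rhs => rw [hn, hcv, h1, h3, h43]
    simp only [nullFrame, Matrix.cons_val]
    rcases hε with rfl | rfl <;> rcases hμ with rfl | rfl <;> module

theorem cov_mem_of_mem (hcov : IsHConnection h cov) (he : IsFrameOn h o e Set.univ)
    {ε μ : ℝ} (hε : ε = 1 ∨ ε = -1) (hμ : μ = 1 ∨ μ = -1)
    (hB : ∀ x, formB ε (connForm cov he.frame) x = μ • formA ε (connForm cov he.frame) x)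
    {σ : Π x, V x} {U : Set (Base m)} (hU : IsOpen U) (hσ : SmoothSectionOn F σ U)
    (hmem : ∀ y ∈ U, σ y ∈ Submodule.span ℝ (Set.range fun i => nullFrame ε μ e i y))
    {x : Base m} (hx : x ∈ U) (v : TangentSpace 𝓘(ℝ, Base m) x) :
    cov σ x v ∈ Submodule.span ℝ (Set.range fun i => nullFrame ε μ e i x) := by
  have hσx : DiffSectionAt F σ x := hσ.diffSectionAt (hU.mem_nhds hx)
  have hnd : ∀ i, DiffSectionAt F (nullFrame ε μ e i) x := fun i =>
    (smoothSectionOn_nullFrame he ε μ i).diffSectionAt Filter.univ_mem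
  have hc := he.differentiableAt_coeff hσx
  have heq : ∀ y ∈ U, σ y = he.frame.coeff 0 y (σ y) • nullFrame ε μ e 0 y +
      he.frame.coeff 1 y (σ y) • nullFrame ε μ e 1 y := by
    intro y hy
    have h1 := hmem y hy
    rw [range_nullFrame, Submodule.mem_span_pair] at h1
    obtain ⟨a, b, hab⟩ := h1
    rw [← hab]
    have hcf := he.coeff_frame (Set.mem_univ y)
    simp [nullFrame, hcf]
  have hd0 := (hnd 0).smul (hc 0)
  have hd1 := (hnd 1).smul (hc 1)
  have hn : ∀ i, nullFrame ε μ e i x ∈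
      Submodule.span ℝ (Set.range fun i => nullFrame ε μ e i x) := fun i =>
    Submodule.subset_span ⟨i, rfl⟩
  have hcn := fun i => cov_nullFrame_mem hcov he hε hμ x v
    (by rw [hB]; rfl) i
  rw [cov_congr cov hσx (hd0.add hd1) (Filter.eventually_of_mem (hU.mem_nhds hx) heq),
    cov_add cov hd0 hd1, cov_smul cov (hc 0) (hnd 0), cov_smul cov (hc 1) (hnd 1)]
  exact Submodule.add_mem _
    (Submodule.add_mem _ (Submodule.smul_mem _ _ (hcn 0)) (Submodule.smul_mem _ _ (hn 0)))
    (Submodule.add_mem _ (Submodule.smul_mem _ _ (hcn 1)) (Submodule.smul_mem _ _ (hn 1)))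

end VectorBundle

/-! ### The Levi-Civita connection of `E⁴₂` -/

variable {cov : CovariantDerivative 𝓘(ℝ, Base 4) (Base 4) T4}

theorem diffSectionAt_constVec (w x : Base 4) : DiffSectionAt (Base 4) (V := T4) (constVec w) x :=
  (smoothSectionOn_constVec w Set.univ).diffSectionAt Filter.univ_mem

theorem form42_nondegenerate {v : Base 4} (hv : ∀ w, form42 v w = 0) : v = 0 := by
  ext i
  have h1 := hv (EuclideanSpace.single i 1)
  rw [form42_apply] at h1
  fin_cases i <;> simpa [Fin.sum_univ_four, sgn] using h1

/-- Constant vector fields are parallel, by the argument for the uniqueness of the Levi-Civita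
connection: `h(∇_u a, b)` is symmetric in `u, a` and skew-symmetric in `a, b`, so it vanishes. -/
theorem IsLeviCivita.cov_constVec (H : IsLeviCivita metricE42 cov) (a x u : Base 4) :
    cov (constVec a) x u = 0 := by
  have hsymm : ∀ u a : Base 4, cov (constVec a) x u = cov (constVec u) x a := by
    intro u a
    have h1 := (CovariantDerivative.torsion_eq_zero_iff cov).1 H.torsion
      (diffSectionAt_constVec u x) (diffSectionAt_constVec a x)
    rw [mlieBracket_constVec] at h1
    exact sub_eq_zero.1 h1
  have hskew : ∀ u a b : Base 4,
      form42 (cov (constVec a) x u) b = -form42 (cov (constVec b) x u) a := by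
    intro u a b
    have h1 := H.hconn.metric (constVec a) (constVec b) x (diffSectionAt_constVec a x)
      (diffSectionAt_constVec b x) u
    have h2 : (fun y => metricE42.inner y (constVec a y) (constVec b y)) =
        fun _ => form42 a b := rfl
    rw [h2, fderiv_fun_const] at h1
    have h3 : 0 = form42 (cov (constVec a) x u) b + form42 a (cov (constVec b) x u) := h1
    exact eq_neg_of_add_eq_zero_left ((congrArg _ (form42_symm _ a)).trans h3.symm)
  refine form42_nondegenerate fun b => ?_
  have k1 := hskew u a b
  have k2 := hskew a b u
  have k3 := hskew b u a
  rw [hsymm u b] at k1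
  rw [hsymm a u] at k2
  rw [hsymm b a] at k3
  linarith

/-- The Levi-Civita connection of `E⁴₂` is the ordinary derivative. -/
theorem IsLeviCivita.cov_eq_fderiv (H : IsLeviCivita metricE42 cov) {σ : Π x, T4 x}
    (hσ : ContDiff ℝ ∞ (σ : Base 4 → Base 4)) (x v : Base 4) :
    cov σ x v = fderiv ℝ (σ : Base 4 → Base 4) x v := by
  have hd : DifferentiableAt ℝ (σ : Base 4 → Base 4) x := hσ.differentiable (by simp) x
  obtain ⟨c, hcσ⟩ : ∃ c : Fin 4 → Base 4 → ℝ, ∀ i y, c i y = WithLp.ofLp (p := 2) (σ y) i :=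
    ⟨_, fun _ _ => rfl⟩
  have hc : ∀ i : Fin 4, HasFDerivAt (c i)
      ((EuclideanSpace.proj i : Base 4 →L[ℝ] ℝ) ∘L fderiv ℝ (σ : Base 4 → Base 4) x) x :=
    fun i => ((EuclideanSpace.proj i : Base 4 →L[ℝ] ℝ).hasFDerivAt.comp x
      hd.hasFDerivAt).congr_of_eventuallyEq (.of_forall (hcσ i))
  have hsum : ∀ w : Base 4, w = ∑ i : Fin 4, w i • EuclideanSpace.single i (1 : ℝ) := by
    intro w
    ext i
    fin_cases i <;> simp [Fin.sum_univ_four]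
  have h1 : σ = fun y => ∑ i : Fin 4, c i y • constVec (EuclideanSpace.single i (1 : ℝ)) y := by
    funext y
    simp only [hcσ]
    exact hsum (σ y)
  have hk := fun i => diffSectionAt_constVec (EuclideanSpace.single i (1 : ℝ)) x
  conv_lhs => rw [h1]
  refine (cov_sum cov (fun i => (hk i).smul (hc i).differentiableAt) v).trans ?_
  refine Eq.trans ?_ (hsum (fderiv ℝ (σ : Base 4 → Base 4) x v)).symm
  refine Finset.sum_congr rfl fun i _ => ?_
  refine (cov_smul cov (hc i).differentiableAt (hk i) v).trans ?_
  rw [(hc i).fderiv]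
  refine (congrArg (fun w => c i x • w + _) (H.cov_constVec _ x v)).trans ?_
  beta_reduce
  rw [smul_zero, zero_add]
  rfl

/-- The Levi-Civita connection of `E⁴₂` is flat, because second derivatives are symmetric. -/
theorem IsLeviCivita.isFlat (H : IsLeviCivita metricE42 cov) : IsFlat cov := by
  intro X Y σ hX hY hσ x
  have hX' : ContDiff ℝ ∞ (X : Base 4 → Base 4) :=
    contDiffOn_univ.1 (smoothSectionOn_vectorField.1 hX)
  have hY' : ContDiff ℝ ∞ (Y : Base 4 → Base 4) :=
    contDiffOn_univ.1 (smoothSectionOn_vectorField.1 hY)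
  have hσ' : ContDiff ℝ ∞ (σ : Base 4 → Base 4) :=
    contDiffOn_univ.1 (smoothSectionOn_vectorField.1 hσ)
  have hdσ : ContDiff ℝ ∞ (fderiv ℝ (σ : Base 4 → Base 4)) :=
    (contDiff_infty_iff_fderiv.1 hσ').2
  have hsymm : IsSymmSndFDerivAt ℝ (σ : Base 4 → Base 4) x :=
    hσ'.contDiffAt.isSymmSndFDerivAt (by
      rw [minSmoothness_of_isRCLikeNormedField]
      exact WithTop.coe_le_coe.2 (le_top : (2 : ℕ∞) ≤ ⊤))
  have key : ∀ Z W : Base 4 → Base 4, ContDiff ℝ ∞ Z →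
      cov (fun y => (cov σ y (Z y) : T4 y)) x (W x) =
      fderiv ℝ (fderiv ℝ (σ : Base 4 → Base 4)) x (W x) (Z x) +
        fderiv ℝ (σ : Base 4 → Base 4) x (fderiv ℝ Z x (W x)) := by
    intro Z W hZ
    have h1 : (fun y => (cov σ y (Z y) : T4 y)) =
        fun y => fderiv ℝ (σ : Base 4 → Base 4) y (Z y) :=
      funext fun y => H.cov_eq_fderiv hσ' y (Z y)
    rw [h1]
    refine (H.cov_eq_fderiv (σ := fun y => fderiv ℝ (σ : Base 4 → Base 4) y (Z y))
      (hdσ.clm_apply hZ) x (W x)).trans ?_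
    rw [fderiv_clm_apply (hdσ.differentiable (by simp) x) (hZ.differentiable (by simp) x)]
    exact add_comm _ _
  have hbr : VectorField.mlieBracket 𝓘(ℝ, Base 4) X Y x =
      fderiv ℝ (Y : Base 4 → Base 4) x (X x) - fderiv ℝ (X : Base 4 → Base 4) x (Y x) := by
    rw [← VectorField.mlieBracketWithin_univ, VectorField.mlieBracketWithin_eq_lieBracketWithin]
    exact congrFun (VectorField.lieBracketWithin_univ (𝕜 := ℝ) (V := (X : Base 4 → Base 4))
      (W := (Y : Base 4 → Base 4))) x
  have h3 : cov σ x (VectorField.mlieBracket 𝓘(ℝ, Base 4) X Y x) =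
      fderiv ℝ (σ : Base 4 → Base 4) x (fderiv ℝ (Y : Base 4 → Base 4) x (X x)) -
      fderiv ℝ (σ : Base 4 → Base 4) x (fderiv ℝ (X : Base 4 → Base 4) x (Y x)) := by
    rw [hbr]
    exact (H.cov_eq_fderiv hσ' x _).trans (map_sub _ _ _)
  have h4 : ∀ p p' q r : Base 4, p = p' → p + q - (p' + r) - (q - r) = 0 := by
    rintro p _ q r rfl
    abel
  unfold curvature
  rw [h3]
  exact (congrArg₂ (fun a b : Base 4 => a - b - _) (key Y X hY') (key X Y hX')).trans
    (h4 _ _ _ _ (hsymm (X x) (Y x)))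

/-! ### Walker manifolds -/

/-- If `∇̂Ω_{ε,2}` is fully light-like, the values of the covariant derivative of the
corresponding structure span a parallel light-like plane field. -/
theorem isWalker_distOf (H : IsLeviCivita metricE42 cov) {o : BundleOrientation (Base 4) T4}
    {e : Fin 4 → Π x, T4 x} (he : IsFrameOn metricE42 o e Set.univ) {ε : ℝ}
    (hε : ε = 1 ∨ ε = -1) (hfull : FullyLightLike metricE42 cov (Omega2 ε e)) :
    IsWalker metricE42 cov (distOf cov (paraJ metricE42 ε e)) := by
  obtain ⟨hA, μ, hμ, hB⟩ := hfull.forms H.hconn he hε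
  have hD := distOf_paraJ H.hconn he hε hμ hA hB
  have hn := inner_nullFrame he hε hμ
  refine ⟨fun x => ?_, fun x a ha b hb => ?_, fun x => ?_, fun U σ hU hσ hmem x hx v => ?_⟩
  · rw [hD, finrank_span_eq_card (linearIndependent_nullFrame he ε μ x), Fintype.card_fin]
  · rw [hD, range_nullFrame, Submodule.mem_span_pair] at ha hb
    obtain ⟨a₁, a₂, rfl⟩ := ha
    obtain ⟨b₁, b₂, rfl⟩ := hb
    simp [hn x]
  · exact ⟨Set.univ, nullFrame ε μ e, isOpen_univ, Set.mem_univ x,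
      smoothSectionOn_nullFrame he ε μ, fun y _ => hD y⟩
  · rw [hD]
    exact cov_mem_of_mem H.hconn he hε hμ hB hU hσ (fun y hy => hD y ▸ hmem y hy) hx v

end FlatNeutral

end

theorem mainTheorem5 :
    (∀ (m : ℕ) (_ : 2 ≤ m)
      (F : Type u) [NormedAddCommGroup F] [NormedSpace ℝ F] [FiniteDimensional ℝ F]
      (V : Base m → Type v) [TopologicalSpace (TotalSpace F V)]
      [∀ x, AddCommGroup (V x)] [∀ x, Module ℝ (V x)] [∀ x, TopologicalSpace (V x)]
      [∀ x, IsTopologicalAddGroup (V x)] [∀ x, ContinuousSMul ℝ (V x)]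
      [FiberBundle F V] [VectorBundle ℝ F V] [ContMDiffVectorBundle ∞ F V 𝓘(ℝ, Base m)]
      (_ : finrank ℝ F = 4)
      (h : NeutralMetric F V) (o : BundleOrientation F V)
      (cov : CovariantDerivative 𝓘(ℝ, Base m) F V) (_ : IsHConnection h cov) (_ : IsFlat cov)
      (e : Fin 4 → Π x, V x) (he : IsFrameOn h o e Set.univ)
      (ε : ℝ) (_ : ε = 1 ∨ ε = -1),
      (FullyLightLike h cov (Omega2 ε e) ↔
        ∃ (f g : Base m → ℝ) (μ : ℝ), ConnRelations ε μ f g (connForm cov he.frame)) ∧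
      (∀ (f g : Base m → ℝ) (μ : ℝ), ConnRelations ε μ f g (connForm cov he.frame) →
        (∀ x v, bivectorConn cov (Omega2 ε e) x v =
          (Real.exp (μ * f x) * fderiv ℝ g x v) • Omega0 ε μ e x) ∧
        ∃ (e' : Fin 4 → Π x, V x) (α' : Base m → Base m →L[ℝ] ℝ),
          IsFrameOn h o e' Set.univ ∧ Omega2 ε e' = Omega2 ε e ∧
          ContDiff ℝ ∞ α' ∧ (∀ x, α' x ≠ 0) ∧
          (∀ x v, bivectorConn cov (Omega2 ε e) x v = α' x v • Omega0 ε μ e' x) ∧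
          ∀ x v, bivectorConn cov (Omega0 ε μ e') x v = 0)) ∧
    (∀ (o : BundleOrientation (Base 4) T4)
      (cov : CovariantDerivative 𝓘(ℝ, Base 4) (Base 4) T4) (_ : IsLeviCivita metricE42 cov)
      (e : Fin 4 → Π x, T4 x) (he : IsFrameOn metricE42 o e Set.univ)
      (ε : ℝ) (_ : ε = 1 ∨ ε = -1),
      (FullyLightLike metricE42 cov (Omega2 ε e) ↔
        ∃ (f g : Base 4 → ℝ) (μ : ℝ), ConnRelations ε μ f g (connForm cov he.frame)) ∧
      (∀ (f g : Base 4 → ℝ) (μ : ℝ), ConnRelations ε μ f g (connForm cov he.frame) →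
        (∀ x v, bivectorConn cov (Omega2 ε e) x v =
          (Real.exp (μ * f x) * fderiv ℝ g x v) • Omega0 ε μ e x) ∧
        ∃ (e' : Fin 4 → Π x, T4 x) (α' : Base 4 → Base 4 →L[ℝ] ℝ),
          IsFrameOn metricE42 o e' Set.univ ∧ Omega2 ε e' = Omega2 ε e ∧
          ContDiff ℝ ∞ α' ∧ (∀ x, α' x ≠ 0) ∧
          (∀ x v, bivectorConn cov (Omega2 ε e) x v = α' x v • Omega0 ε μ e' x) ∧
          ∀ x v, bivectorConn cov (Omega0 ε μ e') x v = 0) ∧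
      (FullyLightLike metricE42 cov (Omega2 ε e) →
        (∃ J : Π x, T4 x →ₗ[ℝ] T4 x, IsParacomplex metricE42 o ε J ∧
          Corresponds metricE42 J (Omega2 ε e)) ∧
        ∀ J : Π x, T4 x →ₗ[ℝ] T4 x, IsParacomplex metricE42 o ε J →
          Corresponds metricE42 J (Omega2 ε e) → IsWalker metricE42 cov (distOf cov J))) := by
  constructor
  · intro m _ F _ _ _ V _ _ _ _ _ _ _ _ _ _ h o cov hcov hflat e he ε hε
    exact ⟨fullyLightLike_iff hcov hflat he hε, fun f g μ H =>
      ⟨H.bivectorConn_Omega2 hcov he hε, H.exists_horizontal_frame hcov he hε⟩⟩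
  · intro o cov hLC e he ε hε
    refine ⟨fullyLightLike_iff hLC.hconn hLC.isFlat he hε, fun f g μ H =>
      ⟨H.bivectorConn_Omega2 hLC.hconn he hε, H.exists_horizontal_frame hLC.hconn he hε⟩,
      fun hfull => ⟨⟨paraJ metricE42 ε e, isParacomplex_paraJ he hε,
        (corresponds_iff he ε).2 rfl⟩, fun J _ hJ => ?_⟩⟩
    rw [(corresponds_iff he ε).1 hJ]
    exact isWalker_distOf hLC he hε hfull
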